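/- Let $q$ be an odd prime power and let $PG(2,q)$ be the projective plane over the finite field with $q$ elements. A Kakeya set in $PG(2,q)$ is a set $K=\bigl(\bigcup_{P\in\ell}\ell_P\bigr)\setminus\ell$, where $\ell$ is a line and, for every point $P$ of $\ell$, $\ell_P$ is a line through $P$ other than $\ell$. A dual oval is a set $\mathcal O$ of $q+1$ lines, no three of which are concurrent. If $\ell\in\mathcal O$, then every point $P$ of $\ell$ except exactly one, called $A$, lies on a unique second line $\ell_P\in\mathcal O$; given a line $\ell_A\neq\ell$ through $A$, let $K(\mathcal O,\ell,\ell_A)=\bigl(\bigcup_{P\in\ell}\ell_P\bigr)\setminus\ell$. An internal nucleus of a set $\Omega$ of points is a point $N\in\Omega$ such that every line through $N$ meets $\Omega$ in exactly one other point. (i) Every Kakeya set $K$ in $PG(2,q)$ satisfies $$|K|\ \ge\ \frac{q(q+1)}{2}+\frac{q-1}{2},$$ and equality holds if and only if $K=K(\mathcal O,\ell,\ell_A)$ for some dual oval $\mathcal O$, some line $\ell\in\mathcal O$ and some line $\ell_A$ as above. (ii) Let $\Omega$ be a set of $q+2$ points of $PG(2,q)$ with an internal nucleus. Then the number of lines that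 meet $\Omega$ is at least $$\frac{(q+1)(q+2)}{2}+\frac{q-1}{2},$$ and if equality holds, then $\Omega$ consists of the points of an irreducible conic together with an external point of it (a point not on the conic that lies on exactly two tangents of the conic). -/

import Mathlib

open scoped LinearAlgebra.Projectivization

namespace KakeyaPlane

/-- The points of the projective plane `PG(2,F)`. -/
abbrev Point (F : Type*) [Field F] : Type _ := ℙ F (Fin 3 → F)

/-- The lines of `PG(2,F)`, given by their homogeneous line coordinates `(u₀ : u₁ : u₂)`. The
incidence `P ∈ ℓ` is Mathlib's (`Configuration.ofField`): the point `(x₀ : x₁ : x₂)` lies on the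
line iff `u₀ x₀ + u₁ x₁ + u₂ x₂ = 0`. -/
abbrev Line (F : Type*) [Field F] : Type _ := ℙ F (Fin 3 → F)

section

variable {F : Type*} [Field F]

/-- The set of points on a line. -/
def pts (l : Line F) : Set (Point F) := {P | P ∈ l}

/-- `m` assigns to every point `P` of `l` a line `m P` through `P` other than `l`
(the values of `m` off `l` play no role). -/
def IsTransversalFamily (l : Line F) (m : Point F → Line F) : Prop :=
  ∀ P ∈ pts l, P ∈ m P ∧ m P ≠ l

/-- The set `(⋃_{P ∈ l} l_P) \ l`, with `l_P = m P`. -/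
def kakeyaSet (l : Line F) (m : Point F → Line F) : Set (Point F) :=
  (⋃ P ∈ pts l, pts (m P)) \ pts l

/-- Kakeya sets (minimal Besicovitch sets) of the plane. -/
def IsKakeyaSet (K : Set (Point F)) : Prop :=
  ∃ (l : Line F) (m : Point F → Line F), IsTransversalFamily l m ∧ K = kakeyaSet l m

/-- A dual oval: a set of `q + 1` lines, no three of which are concurrent. -/
def IsDualOval (O : Set (Line F)) : Prop :=
  O.ncard = Nat.card F + 1 ∧
    ∀ l₁ ∈ O, ∀ l₂ ∈ O, ∀ l₃ ∈ O, l₁ ≠ l₂ → l₁ ≠ l₃ → l₂ ≠ l₃ →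
      ¬ ∃ P : Point F, P ∈ l₁ ∧ P ∈ l₂ ∧ P ∈ l₃

/-- `K` is the Kakeya set `K(O, l, l_A)` associated to a dual oval `O`, a line `l` of `O`, and a
line `lA` other than `l` through the point `A` of `l` that lies on no second line of `O`: for every
other point `P` of `l`, the line `l_P` is the second line of `O` on `P`. -/
def IsAssociated (O : Set (Line F)) (l lA : Line F) (K : Set (Point F)) : Prop :=
  IsDualOval O ∧ l ∈ O ∧
    ∃ A : Point F, A ∈ l ∧ (∀ n ∈ O, A ∈ n → n = l) ∧ A ∈ lA ∧ lA ≠ l ∧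
      ∃ m : Point F → Line F, m A = lA ∧
        (∀ P ∈ pts l, P ≠ A → m P ∈ O ∧ P ∈ m P ∧ m P ≠ l) ∧
        K = kakeyaSet l m

/-- `N` is an internal nucleus of `Ω`: it is a point of `Ω`, and every line through `N` meets `Ω`
in exactly one other point. -/
def IsInternalNucleus (Ω : Set (Point F)) (N : Point F) : Prop :=
  N ∈ Ω ∧ ∀ l : Line F, N ∈ l → ∃! Q : Point F, Q ∈ Ω ∧ Q ≠ N ∧ Q ∈ l

/-- The set of lines that meet `Ω`. -/
def linesMeeting (Ω : Set (Point F)) : Set (Line F) := {l | ∃ P ∈ Ω, P ∈ l}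

/-- The zero set of a ternary form in the plane. For a homogeneous polynomial, vanishing does not
depend on the representative. -/
def zeroLocus (f : MvPolynomial (Fin 3) F) : Set (Point F) :=
  {P | MvPolynomial.eval P.rep f = 0}

/-- `C` is the set of `F`-rational points of an irreducible conic, i.e. of a curve given by a form
of degree `2` that is irreducible over the algebraic closure of `F`. -/
def IsIrreducibleConic (C : Set (Point F)) : Prop :=
  ∃ f : MvPolynomial (Fin 3) F, f.IsHomogeneous 2 ∧
    Irreducible (MvPolynomial.map (algebraMap F (AlgebraicClosure F)) f) ∧ C = zeroLocus f

/-- A tangent of `C`: a line that meets `C` in exactly one point. -/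
def IsTangent (C : Set (Point F)) (l : Line F) : Prop := ∃! P : Point F, P ∈ C ∧ P ∈ l

/-- An external point of a conic `C`: a point off `C` that lies on exactly two tangents of `C`. -/
def IsExternalPoint (C : Set (Point F)) (E : Point F) : Prop :=
  E ∉ C ∧ {l : Line F | E ∈ l ∧ IsTangent C l}.ncard = 2

end

end KakeyaPlane

/-!
Both parts are statements about one configuration. Incidence in `PG(2,q)` is symmetric in points
and lines, so a Kakeya set with lines `l` and `l_P` is, in the dual plane, a set `Ω` with the
internal nucleus `N = l`, and the points of the Kakeya set are the lines off `N` that meet `Ω`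
(`kakeyaSet_eq`). With `N` as the vertical point at infinity and another point `M` of `Ω` as the
horizontal one, the rest of `Ω` is the graph of a function `f : F → F`
(`IsInternalNucleus.exists_graph`), and one has to count the lines `y = m x + c` that are horizontal
or meet this graph.

*The bound.* Let `n` be the number of points of `Ω` on a line. The first two moments of `n` do not
depend on `f`, and `4 [n > 0] ≥ [n odd] + 4 n - n²`, so it is enough to bound the number of odd
lines from below (`card_oddLines_le`). Since `q` is odd, there is an odd line through every point
outside `Ω`, and a tangent through every point of `Ω` other than `N` and at most one further
internal nucleus, which is taken as `M` if it exists. Hence the odd lines, viewed as points of the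
dual affine plane, meet every line off some fixed point, and Jamison's theorem (`jamison`) gives at
least `2 (q - 1)` of them. That two nuclei exclude a third is Segre's argument: if `M` is a nucleus
then `f` is a permutation, the chords at a point of the graph have slopes with product `1`, whereas
all nonzero slopes have product `-1` (`exists_chordCount_eq_zero`).

*Equality.* Then `f` is a permutation, no line has more than three points, and there are exactly
`(q - 1) / 2` lines with three points. By averaging, more than half of the points of the graph are
light: they lie on just one such line, of slope `σ` say, and on just one tangent, whose slope is
then `-σ`. A version of Segre's lemma of tangents shows that the chord between light points with
slopes `σ` and `ρ` has slope `μ` with `μ² = σ ρ` (`IsLight.chord_sq`). This puts all light points on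
a hyperbola with horizontal and vertical asymptotes, and, the light points being a majority, every
other point is on that hyperbola or is its centre (`graph_eq_hyperbola_of_light`). So `Ω` is a conic
through `N` and `M` together with the pole of `N M`. No classification of ovals is needed.

Conversely, for a dual oval the number of lines of a given slope with exactly one point of the graph
is odd, and these numbers have sum `q`, so all of them are `1`; this determines the number of lines
met (`card_metLines_of_arc`).
-/

namespace KakeyaPlane

/-! ### Incidence counts and Jamison's bound -/

section Counting

variable {F : Type*} [Field F] [Fintype F] [DecidableEq F]

/-- The number of points of the graph of `f` on the line `y = l.1 * x + l.2`. -/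
def graphMult (f : F → F) (l : F × F) : ℕ :=
  (Finset.univ.filter fun i => f i = l.1 * i + l.2).card

/-- The number of points on the line `y = l.1 * x + l.2` of the graph of `f` together with the
point at infinity of the horizontal lines. -/
def mult (f : F → F) (l : F × F) : ℕ :=
  graphMult f l + if l.1 = 0 then 1 else 0

lemma graphMult_eq_sum (f : F → F) (l : F × F) :
    graphMult f l = ∑ i, if f i = l.1 * i + l.2 then 1 else 0 := by
  rw [graphMult, Finset.card_filter]

lemma sum_graphMult_slope (f : F → F) (m : F) :
    ∑ c, graphMult f (m, c) = Fintype.card F := by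
  simp_rw [graphMult_eq_sum]
  rw [Finset.sum_comm]
  have : ∀ i : F, (∑ c, if f i = m * i + c then 1 else 0) = 1 := by
    intro i
    rw [Finset.sum_eq_single (f i - m * i)]
    · simp
    · intro c _ hc
      rw [if_neg]
      rintro h
      exact hc (by rw [h]; ring)
    · simp
  simp [this]

lemma sum_graphMult (f : F → F) :
    ∑ l, graphMult f l = Fintype.card F ^ 2 := by
  rw [Fintype.sum_prod_type]
  simp [sum_graphMult_slope, sq]

/-- Two points of the graph lie on exactly one common non-vertical line, and one point of the
graph lies on `q` such lines. -/
lemma sum_incident_pair (f : F → F) (i j : F) :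
    (∑ l : F × F, (if f i = l.1 * i + l.2 then 1 else 0) * (if f j = l.1 * j + l.2 then 1 else 0))
      = if i = j then Fintype.card F else 1 := by
  rw [Fintype.sum_prod_type]
  have h1 : ∀ m : F, (∑ c, (if f i = m * i + c then 1 else 0) *
      (if f j = m * j + c then 1 else 0)) = if f j - f i = m * (j - i) then 1 else 0 := by
    intro m
    rw [Finset.sum_eq_single (f i - m * i)]
    · have : f j = m * j + (f i - m * i) ↔ f j - f i = m * (j - i) := by
        constructor <;> intro h <;> linear_combination h
      simp [this]
    · intro c _ hc
      rw [if_neg, zero_mul]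
      rintro h
      exact hc (by rw [h]; ring)
    · simp
  simp_rw [h1]
  split_ifs with hij
  · subst hij
    simp
  · have hne : j - i ≠ 0 := sub_ne_zero.2 (Ne.symm hij)
    rw [Finset.sum_eq_single ((f j - f i) / (j - i))]
    · simp [hne]
    · intro m _ hm
      rw [if_neg]
      intro h
      exact hm (by rw [h]; field_simp)
    · simp

lemma sum_graphMult_sq (f : F → F) :
    ∑ l, graphMult f l ^ 2 + Fintype.card F = 2 * Fintype.card F ^ 2 := by
  have h : ∑ l, graphMult f l ^ 2
      = ∑ i : F, ∑ j : F, if i = j then Fintype.card F else 1 := by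
    simp_rw [← sum_incident_pair f, graphMult_eq_sum, sq, Finset.sum_mul_sum]
    rw [Finset.sum_comm]
    refine Finset.sum_congr rfl fun i _ => ?_
    rw [Finset.sum_comm]
  have h2 : ∀ i : F, (∑ j : F, if i = j then Fintype.card F else 1) + 1 = 2 * Fintype.card F := by
    intro i
    rw [← Finset.add_sum_erase _ _ (Finset.mem_univ i)]
    rw [Finset.sum_congr rfl (g := fun _ => 1)]
    · have := Fintype.card_pos (α := F)
      simp [Finset.card_erase_of_mem]
      omega
    · intro j hj
      simp [(Finset.ne_of_mem_erase hj).symm]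
  rw [h]
  calc _ = ∑ i : F, ((∑ j : F, if i = j then Fintype.card F else 1) + 1) := by
        rw [Finset.sum_add_distrib]; simp
    _ = _ := by simp [h2]; ring

lemma sum_horizontal (g : F → ℕ) :
    ∑ l : F × F, (if l.1 = 0 then g l.2 else 0) = ∑ c, g c := by
  rw [Fintype.sum_prod_type, Finset.sum_eq_single 0]
  · simp
  · intro b _ hb
    simp [hb]
  · simp

lemma sum_mult (f : F → F) :
    ∑ l, mult f l = Fintype.card F ^ 2 + Fintype.card F := by
  simp only [mult, Finset.sum_add_distrib, sum_graphMult]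
  rw [sum_horizontal (fun _ => 1)]
  simp

lemma sum_mult_sq (f : F → F) :
    ∑ l, mult f l ^ 2 = 2 * (Fintype.card F ^ 2 + Fintype.card F) := by
  have h : ∀ l : F × F, mult f l ^ 2
      = graphMult f l ^ 2 + if l.1 = 0 then (2 * graphMult f (0, l.2) + 1) else 0 := by
    rintro ⟨m, c⟩
    by_cases hm : m = 0
    · subst hm
      simp [mult]; ring
    · simp [mult, hm]
  simp_rw [h, Finset.sum_add_distrib]
  rw [sum_horizontal (fun c => 2 * graphMult f (0, c) + 1), Finset.sum_add_distrib,
    ← Finset.mul_sum, sum_graphMult_slope]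
  have := sum_graphMult_sq f
  simp
  omega

/-- The lines not through the vertical point at infinity that meet the configuration. -/
def metLines (f : F → F) : Finset (F × F) := Finset.univ.filter fun l => mult f l ≠ 0

/-- The lines not through the vertical point at infinity that meet the configuration in an odd
number of points. -/
def oddLines (f : F → F) : Finset (F × F) := Finset.univ.filter fun l => Odd (mult f l)

/-- The sum over all lines of the inequality `4 [n > 0] ≥ [n odd] + 4 n - n²`, whose two sides agree
exactly for `n ≤ 3`; the last sum is the total defect. -/
lemma four_mul_card_metLines (f : F → F) :
    4 * (metLines f).card = (oddLines f).card + 2 * (Fintype.card F ^ 2 + Fintype.card F)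
      + ∑ l, (4 * (if mult f l ≠ 0 then 1 else 0) + mult f l ^ 2
        - ((if Odd (mult f l) then 1 else 0) + 4 * mult f l)) := by
  have key : ∀ n : ℕ, ((if Odd n then 1 else 0) + 4 * n) ≤
      4 * (if n ≠ 0 then 1 else 0) + n ^ 2 := by
    intro n
    rcases Nat.lt_or_ge n 5 with h | h
    · interval_cases n <;> simp <;> decide
    · have : (if Odd n then 1 else 0) ≤ 1 := by split_ifs <;> simp
      rw [if_pos (by omega : n ≠ 0)]
      nlinarith
  have hs : ∑ l, (4 * (if mult f l ≠ 0 then 1 else 0) + mult f l ^ 2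
        - ((if Odd (mult f l) then 1 else 0) + 4 * mult f l))
      + ∑ l, ((if Odd (mult f l) then 1 else 0) + 4 * mult f l)
      = ∑ l, (4 * (if mult f l ≠ 0 then 1 else 0) + mult f l ^ 2) := by
    rw [← Finset.sum_add_distrib]
    exact Finset.sum_congr rfl fun l _ => Nat.sub_add_cancel (key _)
  rw [Finset.sum_add_distrib, Finset.sum_add_distrib, ← Finset.mul_sum, ← Finset.mul_sum,
    sum_mult, sum_mult_sq] at hs
  simp only [metLines, oddLines, Finset.card_filter]
  omega

/-- The excess of the number of met lines over `q (q + 1) / 2` is at least a quarter of the number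
of odd lines. -/
lemma card_oddLines_le (f : F → F) :
    (oddLines f).card + 2 * (Fintype.card F ^ 2 + Fintype.card F) ≤ 4 * (metLines f).card := by
  rw [four_mul_card_metLines f]
  omega

lemma mult_le_three_of_card_eq (f : F → F)
    (h : 4 * (metLines f).card ≤
      (oddLines f).card + 2 * (Fintype.card F ^ 2 + Fintype.card F)) (l : F × F) :
    mult f l ≤ 3 := by
  rw [four_mul_card_metLines f] at h
  have h0 := Nat.le_zero.1 (Nat.le_of_add_le_add_left (h.trans_eq (Nat.add_zero _).symm))
  replace h0 := Finset.sum_eq_zero_iff.1 h0 l (Finset.mem_univ l)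
  by_contra! h4
  have : (if Odd (mult f l) then 1 else 0) ≤ 1 := by split_ifs <;> simp
  have h5 : mult f l ≠ 0 := by omega
  rw [if_pos h5] at h0
  have h6 := Nat.sub_eq_zero_iff_le.1 h0
  have h7 : 5 ≤ mult f l ∨ mult f l = 4 := by omega
  rcases h7 with h7 | h7
  · nlinarith
  · rw [h7] at h6
    revert h6
    decide

omit [DecidableEq F] in
/-- **Jamison's bound** for affine blocking sets: a set of points that meets every line not
through the origin of the affine plane has at least `2 (q - 1)` points. -/
lemma jamison (S : Finset (F × F))
    (hS : ∀ u v : F, (u, v) ≠ (0, 0) → ∃ s ∈ S, u * s.1 + v * s.2 = 1) :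
    2 * (Fintype.card F - 1) ≤ S.card := by
  by_contra! hlt
  let p : MvPolynomial (Fin 2) F :=
    ∏ s ∈ S, (MvPolynomial.C s.1 * MvPolynomial.X 0 + MvPolynomial.C s.2 * MvPolynomial.X 1 - 1)
  have hdeg : p.totalDegree ≤ S.card := by
    refine (MvPolynomial.totalDegree_finsetProd _ _).trans ?_
    rw [Finset.card_eq_sum_ones]
    refine Finset.sum_le_sum fun s _ => ?_
    refine (MvPolynomial.totalDegree_sub _ _).trans (max_le ?_ (by simp))
    refine (MvPolynomial.totalDegree_add _ _).trans (max_le ?_ ?_) <;>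
    · refine (MvPolynomial.totalDegree_mul _ _).trans ?_
      simp
  have h0 := MvPolynomial.sum_eval_eq_zero p (by
    rw [Fintype.card_fin]
    rw [mul_comm] at hlt
    exact hdeg.trans_lt hlt)
  rw [Finset.sum_eq_single 0] at h0
  · simp [p] at h0
  · intro x _ hx
    have hx' : (x 0, x 1) ≠ (0, 0) := by
      intro h
      simp only [Prod.mk.injEq] at h
      exact hx (by ext i; fin_cases i <;> simp [h.1, h.2])
    obtain ⟨s, hs, h1⟩ := hS _ _ hx'
    simp only [p, MvPolynomial.eval_prod]
    refine Finset.prod_eq_zero hs ?_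
    simp only [map_sub, map_add, map_mul, MvPolynomial.eval_C, MvPolynomial.eval_X, map_one]
    linear_combination h1
  · simp

end Counting

/-! ### Odd lines and chords -/

section OddLines

variable {F : Type*} [Field F] [Fintype F] [DecidableEq F]

lemma mult_of_ne_zero (f : F → F) {m : F} (hm : m ≠ 0) (c : F) :
    mult f (m, c) = graphMult f (m, c) := by simp [mult, hm]

lemma exists_odd_mult_of_slope (hq : Odd (Fintype.card F)) (f : F → F) {m : F} (hm : m ≠ 0) :
    ∃ c, Odd (mult f (m, c)) := by
  by_contra! h
  simp_rw [Nat.not_odd_iff_even, mult_of_ne_zero f hm] at h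
  have := Finset.even_sum (s := Finset.univ) (fun c => graphMult f (m, c)) fun c _ => h c
  rw [sum_graphMult_slope] at this
  exact (Nat.not_even_iff_odd.2 hq) this

lemma sum_mult_pencil (f : F → F) {x y : F} (hy : y ≠ f x) :
    ∑ m, mult f (m, y - m * x) = Fintype.card F := by
  have h : ∀ i : F, (∑ m : F, if f i = m * i + (y - m * x) then 1 else 0)
      = if i = x then 0 else 1 := by
    intro i
    split_ifs with hi
    · subst hi
      refine Finset.sum_eq_zero fun m _ => if_neg fun h => hy ?_
      rw [h]; ring
    · have hne : i - x ≠ 0 := sub_ne_zero.2 hi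
      rw [Finset.sum_eq_single ((f i - y) / (i - x))]
      · rw [if_pos]
        field_simp
        ring
      · intro m _ hm
        rw [if_neg]
        intro h
        refine hm ?_
        rw [eq_div_iff hne]
        linear_combination -h
      · simp
  simp only [mult, Finset.sum_add_distrib, graphMult_eq_sum]
  rw [Finset.sum_comm]
  simp_rw [h]
  have h2 := Finset.card_pos.2 (Finset.univ_nonempty (α := F))
  rw [Finset.card_univ] at h2
  rw [Finset.sum_ite]
  simp [Finset.filter_ne', Finset.card_erase_of_mem]
  omega

lemma exists_odd_mult_through (hq : Odd (Fintype.card F)) (f : F → F)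
    (htan : ∀ i, ∃ m, mult f (m, f i - m * i) = 1) (x y : F) :
    ∃ m, Odd (mult f (m, y - m * x)) := by
  by_cases hy : y = f x
  · obtain ⟨m, hm⟩ := htan x
    exact ⟨m, by rw [hy, hm]; exact odd_one⟩
  by_contra! h
  simp_rw [Nat.not_odd_iff_even] at h
  have := Finset.even_sum (s := Finset.univ) (fun m => mult f (m, y - m * x)) fun c _ => h c
  rw [sum_mult_pencil f hy] at this
  exact (Nat.not_even_iff_odd.2 hq) this

/-- If every point of the graph is on a tangent, the odd lines, seen as points of the dual affine
plane, meet every line of that plane off the point `(0, c₀)`; so Jamison's bound applies. -/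
lemma le_card_oddLines_erase (hq : Odd (Fintype.card F)) (f : F → F)
    (htan : ∀ i, ∃ m, mult f (m, f i - m * i) = 1) (c₀ : F) :
    2 * (Fintype.card F - 1) ≤ ((oddLines f).erase (0, c₀)).card := by
  refine (jamison (((oddLines f).erase (0, c₀)).image fun l => (l.1, l.2 - c₀)) ?_).trans
    Finset.card_image_le
  intro u v huv
  have key : ∃ l ∈ oddLines f, u * l.1 + v * (l.2 - c₀) = 1 := by
    by_cases hv : v = 0
    · have hu : u ≠ 0 := fun hu => huv (by rw [hu, hv])
      obtain ⟨c, hc⟩ := exists_odd_mult_of_slope hq f (inv_ne_zero hu)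
      exact ⟨(u⁻¹, c), by simpa [oddLines] using hc, by simp [hv, hu]⟩
    · obtain ⟨m, hm⟩ := exists_odd_mult_through hq f htan (u / v) (1 / v + c₀)
      refine ⟨_, by simpa [oddLines] using hm, ?_⟩
      field_simp
      ring
  obtain ⟨l, hl, h1⟩ := key
  refine ⟨_, Finset.mem_image.2 ⟨l, Finset.mem_erase.2 ⟨?_, hl⟩, rfl⟩, h1⟩
  rintro rfl
  simp at h1

/-- A value `c₀` missed by `f` gives the odd line `y = c₀`, which lifts the bound by one. -/
lemma le_card_oddLines_of_not_surjective (hq : Odd (Fintype.card F)) (f : F → F)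
    (htan : ∀ i, ∃ m, mult f (m, f i - m * i) = 1) (hf : ¬ Function.Surjective f) :
    2 * (Fintype.card F - 1) + 1 ≤ (oddLines f).card := by
  simp only [Function.Surjective, not_forall, not_exists] at hf
  obtain ⟨c₀, hc⟩ := hf
  have h1 : (0, c₀) ∈ oddLines f := by
    refine Finset.mem_filter.2 ⟨Finset.mem_univ _, ?_⟩
    simp [mult, graphMult, hc]
  have := le_card_oddLines_erase hq f htan c₀
  rw [Finset.card_erase_of_mem h1] at this
  have := Finset.card_pos.2 ⟨_, h1⟩
  omega

/-- The slope of the line joining two points of the graph of `f`. -/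
def chord (f : F → F) (i j : F) : F := (f j - f i) / (j - i)

/-- The number of further points of the graph on the line of slope `m` through the point over
`i`. -/
def chordCount (f : F → F) (i m : F) : ℕ :=
  ((Finset.univ.erase i).filter fun j => chord f i j = m).card

omit [Fintype F] [DecidableEq F] in
lemma chord_comm (f : F → F) (i j : F) : chord f i j = chord f j i := by
  rw [chord, chord, ← neg_sub (f i), ← neg_sub i, neg_div_neg_eq]

omit [Fintype F] [DecidableEq F] in
lemma chord_eq_iff (f : F → F) {i j : F} (h : j ≠ i) (m : F) :
    chord f i j = m ↔ f j - f i = m * (j - i) := by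
  rw [chord, div_eq_iff (sub_ne_zero.2 h)]

omit [Fintype F] [DecidableEq F] in
lemma chord_ne_zero {f : F → F} (hf : Function.Injective f) {i j : F} (h : j ≠ i) :
    chord f i j ≠ 0 :=
  div_ne_zero (sub_ne_zero.2 (hf.ne h)) (sub_ne_zero.2 h)

lemma graphMult_eq_chordCount (f : F → F) (i m : F) :
    graphMult f (m, f i - m * i) = chordCount f i m + 1 := by
  have h : (Finset.univ.filter fun j => f j = m * j + (f i - m * i))
      = insert i ((Finset.univ.erase i).filter fun j => chord f i j = m) := by
    ext j
    by_cases hj : j = i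
    · subst hj; simp
    · simp only [Finset.mem_filter, Finset.mem_univ, true_and, Finset.mem_insert, hj, false_or,
        Finset.mem_erase, ne_eq, not_false_eq_true, and_self]
      rw [chord_eq_iff f hj]
      constructor <;> intro h <;> linear_combination h
  rw [graphMult, chordCount]
  dsimp only
  rw [h, Finset.card_insert_of_notMem (by simp)]

lemma chordCount_chord_comm (f : F → F) {i j : F} (h : j ≠ i) :
    chordCount f i (chord f i j) = chordCount f j (chord f i j) := by
  have h1 := graphMult_eq_chordCount f i (chord f i j)
  have h2 := graphMult_eq_chordCount f j (chord f i j)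
  have h3 := (chord_eq_iff f h _).1 (rfl : chord f i j = chord f i j)
  have : f i - chord f i j * i = f j - chord f i j * j := by linear_combination -h3
  rw [this] at h1
  omega

lemma prod_erase_zero : ∏ x ∈ Finset.univ.erase (0 : F), x = -1 := by
  have h := FiniteField.prod_univ_units_id_eq_neg_one (K := F)
  have h2 := congrArg (Units.val) h
  rw [Units.coe_prod] at h2
  rw [Units.val_neg, Units.val_one] at h2
  rw [← h2]
  symm
  refine Finset.prod_bij (fun u _ => (u : F)) (by simp) (by simp [Units.val_inj]) ?_ (by simp)
  intro b hb
  exact ⟨Units.mk0 b (Finset.ne_of_mem_erase hb), Finset.mem_univ _, rfl⟩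

/-- For a permutation `f`, the differences to a fixed value have product `-1`. -/
lemma prod_sub_of_injective {f : F → F} (hf : Function.Injective f) (i : F) :
    ∏ j ∈ Finset.univ.erase i, (f j - f i) = -1 := by
  rw [← prod_erase_zero (F := F)]
  refine Finset.prod_bij (fun j _ => f j - f i) ?_ ?_ ?_ (fun _ _ => rfl)
  · intro j hj
    simpa [sub_eq_zero, hf.eq_iff] using hj
  · intro j _ k _ h
    exact hf (sub_left_inj.1 h)
  · intro b hb
    obtain ⟨j, hj⟩ := (Finite.injective_iff_surjective.1 hf) (b + f i)
    refine ⟨j, ?_, by rw [hj]; ring⟩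
    rw [Finset.mem_erase] at hb ⊢
    refine ⟨?_, Finset.mem_univ _⟩
    rintro rfl
    exact hb.1 (by linear_combination -hj)

lemma prod_chord {f : F → F} (hf : Function.Injective f) (i : F) :
    ∏ j ∈ Finset.univ.erase i, chord f i j = 1 := by
  have h1 := prod_sub_of_injective hf i
  have h2 := prod_sub_of_injective (Function.injective_id (α := F)) i
  simp only [id] at h2
  simp only [chord, Finset.prod_div_distrib]
  rw [h1, h2]
  simp

lemma sum_chordCount {f : F → F} (hf : Function.Injective f) (i : F) :
    ∑ m ∈ Finset.univ.erase 0, chordCount f i m = (Finset.univ.erase (0 : F)).card := by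
  have := Finset.card_eq_sum_card_fiberwise (s := Finset.univ.erase i) (t := Finset.univ.erase 0)
    (f := chord f i) (by
      intro j hj
      simpa using chord_ne_zero hf (by simpa using hj))
  rw [Finset.card_erase_of_mem (Finset.mem_univ _)] at this ⊢
  exact this.symm

/-- A product over the chords at a point, arranged by slope. -/
lemma prod_comp_chord {f : F → F} (hf : Function.Injective f) (i : F) (φ : F → F) :
    ∏ j ∈ Finset.univ.erase i, φ (chord f i j)
      = ∏ m ∈ Finset.univ.erase 0, φ m ^ chordCount f i m := by
  rw [← Finset.prod_fiberwise_of_maps_to' (s := Finset.univ.erase i) (t := Finset.univ.erase 0)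
    (g := chord f i) (f := φ)]
  · simp [chordCount, Finset.prod_const]
  · intro j hj
    simpa using chord_ne_zero hf (by simpa using hj)

/-- Three internal nuclei are impossible in odd characteristic: the chords at a point of the graph
of a permutation have product `1`, while all nonzero slopes have product `-1`. -/
lemma exists_chordCount_eq_zero (h2 : (2 : F) ≠ 0) {f : F → F} (hf : Function.Injective f) (i : F) :
    ∃ m ≠ 0, chordCount f i m = 0 := by
  by_contra! h
  have h1 : ∀ m ∈ Finset.univ.erase (0 : F), 1 ≤ chordCount f i m := fun m hm =>
    Nat.one_le_iff_ne_zero.2 (h m (Finset.ne_of_mem_erase hm))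
  have h3 := (Finset.sum_eq_sum_iff_of_le h1).1 (by rw [sum_chordCount hf]; simp)
  have h4 := prod_comp_chord hf i id
  simp only [id] at h4
  rw [prod_chord hf, Finset.prod_congr rfl (g := fun m => m), prod_erase_zero] at h4
  · exact h2 (by linear_combination h4)
  · intro m hm
    rw [← h3 m hm, pow_one]

lemma exists_tangent_of_injective (h2 : (2 : F) ≠ 0) {f : F → F} (hf : Function.Injective f)
    (i : F) : ∃ m, mult f (m, f i - m * i) = 1 := by
  obtain ⟨m, hm, h⟩ := exists_chordCount_eq_zero h2 hf i
  exact ⟨m, by rw [mult_of_ne_zero f hm, graphMult_eq_chordCount, h]⟩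

end OddLines

/-! ### Light points and the lemma of tangents -/

section Light

variable {F : Type*} [Field F] [Fintype F] [DecidableEq F]

/-- The point of the graph of `f` over `i` is *light*, with slope `σ`, if among the lines of nonzero
slope through it, the one of slope `σ` contains exactly two further points of the graph, the one of
slope `-σ` contains none, and all others contain exactly one. -/
def IsLight (f : F → F) (i σ : F) : Prop :=
  σ ≠ 0 ∧ ∀ m ≠ 0, chordCount f i m = if m = σ then 2 else if m = -σ then 0 else 1

lemma prod_comp_chord_of_double {f : F → F} (hf : Function.Injective f) {i σ τ : F} (hσ : σ ≠ 0)
    (hτ : τ ≠ 0) (hστ : τ ≠ σ)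
    (h : ∀ m ≠ 0, chordCount f i m = if m = σ then 2 else if m = τ then 0 else 1) (φ : F → F) :
    (∏ j ∈ Finset.univ.erase i, φ (chord f i j)) * φ τ
      = (∏ m ∈ Finset.univ.erase 0, φ m) * φ σ := by
  have hs : σ ∈ Finset.univ.erase (0 : F) := by simpa using hσ
  have ht : τ ∈ (Finset.univ.erase (0 : F)).erase σ := by simp [hτ, hστ]
  rw [prod_comp_chord hf, ← Finset.mul_prod_erase _ _ hs, ← Finset.mul_prod_erase _ _ ht,
    ← Finset.mul_prod_erase _ φ hs, ← Finset.mul_prod_erase _ φ ht, h σ hσ, h τ hτ, if_pos rfl,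
    if_neg hστ, if_pos rfl]
  rw [Finset.prod_congr rfl (g := φ)]
  · ring
  · intro m hm
    simp only [Finset.mem_erase] at hm
    rw [h m hm.2.2.1, if_neg hm.2.1, if_neg hm.1, pow_one]

/-- If one slope at a point is doubled and one is missing, the missing one is the negative of the
doubled one: compare the product of the chords with the product of all slopes. -/
lemma isLight_of_double {f : F → F} (hf : Function.Injective f) {i σ τ : F} (hσ : σ ≠ 0)
    (hτ : τ ≠ 0) (hστ : τ ≠ σ)
    (h : ∀ m ≠ 0, chordCount f i m = if m = σ then 2 else if m = τ then 0 else 1) :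
    IsLight f i σ := by
  have h1 := prod_comp_chord_of_double hf hσ hτ hστ h id
  simp only [id] at h1
  rw [prod_chord hf, prod_erase_zero, one_mul, neg_one_mul] at h1
  subst h1
  exact ⟨hσ, h⟩

omit [Fintype F] [DecidableEq F] in
lemma neg_ne_self_of_two_ne_zero (h2 : (2 : F) ≠ 0) {σ : F} (hσ : σ ≠ 0) : -σ ≠ σ := by
  intro h
  have : 2 * σ = 0 := by linear_combination -h
  simp [h2, hσ] at this

lemma IsLight.chord_ne_neg {f : F → F} {i σ : F} (h2 : (2 : F) ≠ 0)
    (h : IsLight f i σ) {j : F} (hij : j ≠ i) : chord f i j ≠ -σ := by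
  intro hc
  have h3 := h.2 (-σ) (neg_ne_zero.2 h.1)
  rw [if_neg (neg_ne_self_of_two_ne_zero h2 h.1), if_pos rfl, chordCount,
    Finset.card_eq_zero] at h3
  have : j ∈ (Finset.univ.erase i).filter fun j => chord f i j = -σ := by simp [hij, hc]
  simp [h3] at this

lemma IsLight.eq_of_chord_eq {f : F → F} (hf : Function.Injective f) {i σ : F}
    (h : IsLight f i σ) {j k : F} (hj : j ≠ i) (hk : k ≠ i) (hjk : j ≠ k)
    (hc : chord f i j = chord f i k) : chord f i j = σ := by
  by_contra hne
  have h3 := h.2 _ (chord_ne_zero hf hj)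
  rw [if_neg hne] at h3
  have h4 : chordCount f i (chord f i j) ≤ 1 := by rw [h3]; split_ifs <;> simp
  rw [chordCount, Finset.card_le_one] at h4
  exact hjk (h4 j (by simp [hj]) k (by simp [hk, hc]))

lemma IsLight.chord_mul_prod {f : F → F} (hf : Function.Injective f) (h2 : (2 : F) ≠ 0) {i σ : F}
    (h : IsLight f i σ) {j : F} (hij : j ≠ i) (hne : chord f i j ≠ σ) :
    (∏ k ∈ (Finset.univ.erase i).erase j, (f k - f i - chord f i j * (k - i))) * (j - i)
      * (σ + chord f i j) * chord f i j = σ - chord f i j := by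
  have hneg := h.chord_ne_neg h2 hij
  have hinj : ∀ k, k ≠ i → k ≠ j → chord f i k ≠ chord f i j := fun k hk hkj hc =>
    hne (by rw [← hc]; exact h.eq_of_chord_eq hf hk hij hkj hc)
  set μ := chord f i j with hμ
  have hμ0 : μ ≠ 0 := chord_ne_zero hf hij
  have h1 := prod_comp_chord_of_double hf h.1 (neg_ne_zero.2 h.1)
    (neg_ne_self_of_two_ne_zero h2 h.1) h.2 (fun m => if m = μ then 1 else m - μ)
  simp only [if_neg hneg.symm, if_neg hne.symm] at h1
  -- the chord to `j` itself contributes the factor `1`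
  have hj : j ∈ Finset.univ.erase i := by simp [hij]
  rw [← Finset.mul_prod_erase _ _ hj, if_pos rfl, one_mul] at h1
  have h3 : ∏ k ∈ (Finset.univ.erase i).erase j,
      (if chord f i k = μ then 1 else chord f i k - μ)
      = (∏ k ∈ (Finset.univ.erase i).erase j, (f k - f i - μ * (k - i)))
        / ∏ k ∈ (Finset.univ.erase i).erase j, (k - i) := by
    rw [← Finset.prod_div_distrib]
    refine Finset.prod_congr rfl fun k hk => ?_
    simp only [Finset.mem_erase] at hk
    have hki : k - i ≠ 0 := sub_ne_zero.2 hk.2.1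
    rw [if_neg (hinj k hk.2.1 hk.1), chord]
    field_simp
  have h4 : (j - i) * ∏ k ∈ (Finset.univ.erase i).erase j, (k - i) = -1 := by
    rw [Finset.mul_prod_erase _ (fun k => k - i) hj]
    exact prod_sub_of_injective (Function.injective_id (α := F)) i
  have h5 : μ * ∏ m ∈ Finset.univ.erase 0, (if m = μ then 1 else m - μ) = 1 := by
    have hμm : μ ∈ Finset.univ.erase (0 : F) := by simpa using hμ0
    have h0m : (0 : F) ∈ Finset.univ.erase μ := by simpa using hμ0.symm
    have h6 := prod_sub_of_injective (Function.injective_id (α := F)) μ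
    simp only [id] at h6
    rw [← Finset.mul_prod_erase _ _ h0m, Finset.erase_right_comm] at h6
    rw [← Finset.mul_prod_erase _ _ hμm, if_pos rfl, one_mul]
    rw [Finset.prod_congr rfl (g := fun m => m - μ)]
    · linear_combination -h6
    · intro m hm
      rw [if_neg (Finset.ne_of_mem_erase hm)]
  rw [h3] at h1
  set A := ∏ k ∈ (Finset.univ.erase i).erase j, (f k - f i - μ * (k - i))
  set B := ∏ k ∈ (Finset.univ.erase i).erase j, (k - i)
  set D := ∏ m ∈ Finset.univ.erase 0, (if m = μ then 1 else m - μ)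
  have hB : B ≠ 0 := by
    intro hB
    rw [hB] at h4
    simp at h4
  have h7 : A * (-σ - μ) = D * (σ - μ) * B := by
    field_simp at h1
    linear_combination h1
  linear_combination (-(j - i) * μ) * h7 - (σ - μ) * μ * D * h4 + (σ - μ) * h5

/-- A form of Segre's lemma of tangents: the chord between two light points has slope squared equal
to the product of their slopes. -/
lemma IsLight.chord_sq {f : F → F} (hf : Function.Injective f) (h2 : (2 : F) ≠ 0) {i j σ ρ : F}
    (hi : IsLight f i σ) (hj : IsLight f j ρ) (hij : j ≠ i) :
    chord f i j ^ 2 = σ * ρ := by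
  have hμ0 := chord_ne_zero hf hij
  have hcc := chordCount_chord_comm f hij
  rw [hi.2 _ hμ0, hj.2 _ hμ0] at hcc
  have hneg := hi.chord_ne_neg h2 hij
  have hneg' := hj.chord_ne_neg h2 hij.symm
  rw [chord_comm] at hneg'
  rw [if_neg hneg, if_neg hneg'] at hcc
  by_cases h1 : chord f i j = σ
  · have h3 : chord f i j = ρ := by
      by_contra h3
      simp [h1] at hcc
      exact h3 (h1.trans hcc)
    rw [← h1, ← h3, sq]
  · have h3 : chord f i j ≠ ρ := by
      intro h3
      simp [h1, if_pos h3] at hcc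
    have e1 := hi.chord_mul_prod hf h2 hij h1
    have e2 := hj.chord_mul_prod hf h2 hij.symm (by rwa [chord_comm])
    rw [Finset.erase_right_comm, chord_comm f j i] at e2
    set μ := chord f i j with hμ
    have h4 : f j - f i = μ * (j - i) := (chord_eq_iff f hij _).1 rfl
    have e3 : ∏ k ∈ (Finset.univ.erase i).erase j, (f k - f j - μ * (k - j))
        = ∏ k ∈ (Finset.univ.erase i).erase j, (f k - f i - μ * (k - i)) :=
      Finset.prod_congr rfl fun k _ => by linear_combination -h4
    rw [e3] at e2
    set G := ∏ k ∈ (Finset.univ.erase i).erase j, (f k - f i - μ * (k - i))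
    have hG : G * (j - i) * μ ≠ 0 := by
      intro h0
      refine h1 ?_
      linear_combination e1 - (σ + μ) * h0
    have h5 : G * (j - i) * μ * ((2 : F) * (μ ^ 2 - σ * ρ)) = 0 := by
      linear_combination (σ - μ) * e2 - (ρ - μ) * e1
    have h6 := (mul_eq_zero.1 ((mul_eq_zero.1 h5).resolve_left hG)).resolve_left h2
    linear_combination h6

/-- A family of pairs of values, any two of which agree in one of the two entries,
is constant in one of them. -/
lemma constant_of_pairwise_or {ι α β : Type*} (S : Set ι) (g : ι → α) (h : ι → β)
    (hor : ∀ i ∈ S, ∀ j ∈ S, g i = g j ∨ h i = h j) :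
    (∀ i ∈ S, ∀ j ∈ S, g i = g j) ∨ (∀ i ∈ S, ∀ j ∈ S, h i = h j) := by
  by_contra! hcon
  obtain ⟨⟨a, ha, b, hb, hab⟩, ⟨c, hc, d, hd, hcd⟩⟩ := hcon
  rcases hor c hc a ha with h1 | h1 <;> rcases hor c hc b hb with h2 | h2 <;>
  rcases hor d hd a ha with h3 | h3 <;> rcases hor d hd b hb with h4 | h4 <;>
  rcases hor a ha b hb with h5 | h5 <;> rcases hor c hc d hd with h6 | h6 <;>
  simp_all

end Light

/-! ### Light points lie on a hyperbola -/

section Hyperbola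

variable {F : Type*} [Field F] [Fintype F] [DecidableEq F]

/-- Inverting the coordinates at a light point turns the condition on the chords between light
points into one on slopes `±1`, so the inverted points are collinear. -/
lemma light_on_hyperbola {f : F → F} (hf : Function.Injective f) (h2 : (2 : F) ≠ 0)
    (Λ : Finset F) (hΛ : 4 ≤ Λ.card) (σ : F → F) (hl : ∀ i ∈ Λ, IsLight f i (σ i)) :
    ∃ x₀ y₀ k : F, k ≠ 0 ∧ ∀ i ∈ Λ, (i - x₀) * (f i - y₀) = k := by
  obtain ⟨p, hp⟩ := Finset.card_pos.1 (by omega : 0 < Λ.card)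
  have hs := (hl p hp).1
  have hc3 : 3 ≤ (Λ.erase p).card := by rw [Finset.card_erase_of_mem hp]; omega
  obtain ⟨p₁, hp₁⟩ := Finset.card_pos.1 (by omega : 0 < (Λ.erase p).card)
  have ha : ∀ i ∈ Λ.erase p, i - p ≠ 0 := fun i hi => sub_ne_zero.2 (Finset.ne_of_mem_erase hi)
  have hF : ∀ i ∈ Λ.erase p, f i - f p ≠ 0 := fun i hi =>
    sub_ne_zero.2 (hf.ne (Finset.ne_of_mem_erase hi))
  -- the reciprocals of the coordinates relative to the point over `p`
  have hconst := constant_of_pairwise_or (Λ.erase p : Set F)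
    (fun i => σ p / (f i - f p) - 1 / (i - p)) (fun i => σ p / (f i - f p) + 1 / (i - p)) (by
      intro i hi j hj
      rw [Finset.mem_coe] at hi hj
      by_cases hij : i = j
      · exact Or.inl (by rw [hij])
      have hi' := Finset.mem_of_mem_erase hi
      have hj' := Finset.mem_of_mem_erase hj
      have e1 := (hl p hp).chord_sq hf h2 (hl i hi') (Finset.ne_of_mem_erase hi)
      have e2 := (hl p hp).chord_sq hf h2 (hl j hj') (Finset.ne_of_mem_erase hj)
      have e3 := (hl i hi').chord_sq hf h2 (hl j hj') (Ne.symm hij)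
      have hai := ha i hi
      have haj := ha j hj
      have hFi := hF i hi
      have hFj := hF j hj
      have hji : j - i ≠ 0 := sub_ne_zero.2 (Ne.symm hij)
      have e4 : (σ p * chord f i j) ^ 2 = (chord f p i * chord f p j) ^ 2 := by
        rw [mul_pow, mul_pow, e1, e2, e3]; ring
      rcases sq_eq_sq_iff_eq_or_eq_neg.1 e4 with e5 | e5
      · left
        simp only [chord] at e5
        field_simp at e5 ⊢
        linear_combination e5
      · right
        simp only [chord] at e5
        field_simp at e5 ⊢
        linear_combination e5)
  have hex : ∃ ε d : F, ε ^ 2 = 1 ∧ ∀ i ∈ Λ.erase p,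
      σ p * (i - p) = ε * (f i - f p) + d * (i - p) * (f i - f p) := by
    rcases hconst with h | h
    · refine ⟨1, σ p / (f p₁ - f p) - 1 / (p₁ - p), by ring, fun i hi => ?_⟩
      have h1 := h p₁ hp₁ i hi
      have hai := ha i hi
      have hFi := hF i hi
      rw [h1]
      field_simp
      ring
    · refine ⟨-1, σ p / (f p₁ - f p) + 1 / (p₁ - p), by ring, fun i hi => ?_⟩
      have h1 := h p₁ hp₁ i hi
      have hai := ha i hi
      have hFi := hF i hi
      rw [h1]
      field_simp
      ring
  obtain ⟨ε, d, hε, h⟩ := hex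
  have hε0 : ε ≠ 0 := by rintro rfl; simp at hε
  have hd : d ≠ 0 := by
    rintro rfl
    have hch : ∀ i ∈ Λ.erase p, chord f p i = ε * σ p := by
      intro i hi
      rw [chord_eq_iff f (Finset.ne_of_mem_erase hi)]
      linear_combination (-ε) * h i hi - (f i - f p) * hε
    have hε1 : ε = 1 := by
      refine (sq_eq_sq_iff_eq_or_eq_neg.1 (hε.trans (one_pow 2).symm)).resolve_right ?_
      rintro rfl
      exact (hl p hp).chord_ne_neg h2 (Finset.ne_of_mem_erase hp₁) (by rw [hch p₁ hp₁]; ring)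
    have hcount := (hl p hp).2 _ hs
    rw [if_pos rfl, chordCount] at hcount
    have hsub : Λ.erase p ⊆ (Finset.univ.erase p).filter fun j => chord f p j = σ p := by
      intro i hi
      simp [Finset.ne_of_mem_erase hi, hch i hi, hε1]
    have := Finset.card_le_card hsub
    omega
  refine ⟨p - ε / d, f p + σ p / d, -(ε * σ p / d ^ 2), ?_, ?_⟩
  · exact neg_ne_zero.2 (div_ne_zero (mul_ne_zero hε0 hs) (pow_ne_zero _ hd))
  · intro i hi
    by_cases hip : i = p
    · subst hip
      field_simp
      ring
    · have := h i (Finset.mem_erase.2 ⟨hip, hi⟩)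
      field_simp
      linear_combination (-d) * this

omit [Fintype F] in
lemma card_filter_mul_sq_eq_le_two (S : Finset F) {a x₀ c : F} (ha : a ≠ 0) :
    (S.filter fun i => a * (i - x₀) ^ 2 = c).card ≤ 2 := by
  rcases (S.filter fun i => a * (i - x₀) ^ 2 = c).eq_empty_or_nonempty with h | ⟨j, hj⟩
  · simp [h]
  · refine (Finset.card_le_card (t := {j, 2 * x₀ - j}) ?_).trans Finset.card_le_two
    intro i hi
    rw [Finset.mem_filter] at hi hj
    have h1 : (i - x₀) ^ 2 = (j - x₀) ^ 2 := mul_left_cancel₀ ha (hi.2.trans hj.2.symm)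
    rw [Finset.mem_insert, Finset.mem_singleton]
    rcases sq_eq_sq_iff_eq_or_eq_neg.1 h1 with h | h
    · left; linear_combination h
    · right; linear_combination h

/-- If more than half of the points of the graph of a permutation are light, the graph consists of
a hyperbola with horizontal and vertical asymptotes and of its centre. -/
theorem graph_eq_hyperbola_of_light {f : F → F} (hf : Function.Injective f) (h2 : (2 : F) ≠ 0)
    (Λ : Finset F) (hq : 5 ≤ Fintype.card F) (hΛ : Fintype.card F + 3 ≤ 2 * Λ.card) (σ : F → F)
    (hl : ∀ i ∈ Λ, IsLight f i (σ i)) :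
    ∃ x₀ k : F, k ≠ 0 ∧ ∀ x ≠ x₀, (x - x₀) * (f x - f x₀) = k := by
  obtain ⟨x₀, y₀, k, hk, hcon⟩ := light_on_hyperbola hf h2 Λ (by omega) σ hl
  have hA : ∀ i ∈ Λ, i - x₀ ≠ 0 := by
    intro i hi h0
    have := hcon i hi
    rw [h0, zero_mul] at this
    exact hk this.symm
  have hfi : ∀ i ∈ Λ, f i = y₀ + k / (i - x₀) := by
    intro i hi
    have h0 := hA i hi
    field_simp
    linear_combination hcon i hi
  have hch : ∀ i ∈ Λ, ∀ j ∈ Λ, j ≠ i → chord f i j = -k / ((i - x₀) * (j - x₀)) := by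
    intro i hi j hj hij
    have h0 := hA i hi
    have h1 := hA j hj
    rw [chord_eq_iff f hij, hfi i hi, hfi j hj]
    field_simp
    ring
  have hw : ∀ i ∈ Λ, ∀ j ∈ Λ, j ≠ i →
      (σ i * (i - x₀) ^ 2) * (σ j * (j - x₀) ^ 2) = k ^ 2 := by
    intro i hi j hj hij
    have h0 := hA i hi
    have h1 := hA j hj
    have h3 := (hl i hi).chord_sq hf h2 (hl j hj) hij
    rw [hch i hi j hj hij] at h3
    field_simp at h3
    linear_combination -h3
  have hw2 : ∀ i ∈ Λ, σ i * (i - x₀) ^ 2 = k ∨ σ i * (i - x₀) ^ 2 = -k := by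
    intro i hi
    obtain ⟨j, hj, l, hlm, hjl⟩ := Finset.one_lt_card.1
      (by rw [Finset.card_erase_of_mem hi]; omega : 1 < (Λ.erase i).card)
    rw [Finset.mem_erase] at hj hlm
    have e1 := hw i hi j hj.2 hj.1
    have e2 := hw i hi l hlm.2 hlm.1
    have e3 := hw j hj.2 l hlm.2 hjl.symm
    refine sq_eq_sq_iff_eq_or_eq_neg.1 (mul_right_cancel₀ (pow_ne_zero 2 hk) ?_)
    generalize σ i * (i - x₀) ^ 2 = a at e1 e2 e3 ⊢
    generalize σ j * (j - x₀) ^ 2 = b at e1 e2 e3 ⊢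
    generalize σ l * (l - x₀) ^ 2 = c at e1 e2 e3 ⊢
    linear_combination (-a ^ 2) * e3 + a * c * e1 + k ^ 2 * e2
  -- the slope of the missing line at a light point is that of the tangent of the hyperbola
  have hwk : ∀ i ∈ Λ, σ i * (i - x₀) ^ 2 = k := by
    by_contra! hne
    obtain ⟨i₀, hi₀, hne⟩ := hne
    have hi₀' := (hw2 i₀ hi₀).resolve_left hne
    have hall : ∀ i ∈ Λ, σ i * (i - x₀) ^ 2 = -k := by
      intro i hi
      by_cases h : i = i₀
      · rw [h, hi₀']
      · have := hw i₀ hi₀ i hi h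
        rw [hi₀'] at this
        exact mul_left_cancel₀ (neg_ne_zero.2 hk) (by linear_combination this)
    have hdisj : Disjoint Λ (Λ.image fun i => 2 * x₀ - i) := by
      rw [Finset.disjoint_left]
      intro j hj hj'
      obtain ⟨i, hi, rfl⟩ := Finset.mem_image.1 hj'
      have h0 := hA i hi
      have hne' : 2 * x₀ - i ≠ i := by
        intro h
        exact h0 ((mul_eq_zero.1 (by linear_combination -h : 2 * (i - x₀) = 0)).resolve_left h2)
      refine (hl i hi).chord_ne_neg h2 hne' ?_
      have h1 := hA _ hj
      rw [hch i hi _ hj hne', div_eq_iff (mul_ne_zero h0 h1)]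
      linear_combination -hall i hi
    have h3 := Finset.card_le_univ (Λ ∪ Λ.image fun i => 2 * x₀ - i)
    rw [Finset.card_union_of_disjoint hdisj, Finset.card_image_of_injective _
      (fun a b h => by simpa using h)] at h3
    omega
  have hmain : ∀ R, (R - x₀) * (f R - y₀) = k ∨ (R = x₀ ∧ f R = y₀) := by
    intro R
    by_contra! hR
    obtain ⟨hR1, hR2⟩ := hR
    have hRΛ : R ∉ Λ := fun h => hR1 (hcon R h)
    have hden : ∀ i ∈ Λ, (i - x₀) * (f R - y₀) - k ≠ 0 := by
      intro i hi h
      have h1 : f R = f i := by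
        have h0 := hA i hi
        rw [hfi i hi]
        field_simp
        linear_combination h
      exact hRΛ (by rwa [hf h1])
    -- the second intersection of the hyperbola with the line from a light point to the point
    -- over `R`
    let g : F → F := fun i => x₀ - k * (R - i) / ((i - x₀) * (f R - y₀) - k)
    have hginj : Set.InjOn g Λ := by
      intro i hi j hj h
      have h0 := hden i hi
      have h1 := hden j hj
      have h3 : k * (R - i) / ((i - x₀) * (f R - y₀) - k)
          = k * (R - j) / ((j - x₀) * (f R - y₀) - k) := sub_right_injective h
      rw [div_eq_div_iff h0 h1] at h3
      have h4 : (k * ((R - x₀) * (f R - y₀) - k)) * (i - j) = 0 := by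
        linear_combination -h3
      exact sub_eq_zero.1 ((mul_eq_zero.1 h4).resolve_left
        (mul_ne_zero hk (sub_ne_zero.2 hR1)))
    let Λ' := Λ.filter fun i => ¬ (f R - y₀) * (i - x₀) ^ 2 = k * (R - x₀)
    have hdisj : Disjoint Λ (Λ'.image g) := by
      rw [Finset.disjoint_left]
      intro j hj hj'
      obtain ⟨i, hi, hij⟩ := Finset.mem_image.1 hj'
      obtain ⟨hi, hne⟩ := Finset.mem_filter.1 hi
      have hRi : R ≠ i := fun h => hRΛ (h ▸ hi)
      have h0 := hA i hi
      have hRi0 : R - i ≠ 0 := sub_ne_zero.2 hRi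
      have hd := hden i hi
      have hμ : chord f i R = ((i - x₀) * (f R - y₀) - k) / ((i - x₀) * (R - i)) := by
        rw [chord, hfi i hi]
        field_simp
        ring
      have hb : j - x₀ = -(k * (R - i) / ((i - x₀) * (f R - y₀) - k)) := by
        rw [← hij]; ring
      have hμ2 : chord f i R = -k / ((i - x₀) * (j - x₀)) := by
        rw [hμ, hb]
        field_simp
      by_cases hji : j = i
      · refine (hl i hi).chord_ne_neg h2 hRi ?_
        rw [hμ2, hji, div_eq_iff (mul_ne_zero h0 h0)]
        linear_combination hwk i hi
      · have h5 : chord f i R = σ i := by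
          refine (hl i hi).eq_of_chord_eq hf hRi hji (fun h => hRΛ (h ▸ hj)) ?_
          rw [hμ2, hch i hi j hj hji]
        rw [hμ, div_eq_iff (mul_ne_zero h0 hRi0)] at h5
        apply hne
        linear_combination (i - x₀) * h5 + (R - i) * hwk i hi
    have h3 := Finset.card_le_univ (Λ ∪ Λ'.image g)
    rw [Finset.card_union_of_disjoint hdisj, Finset.card_image_of_injOn
      (hginj.mono (Finset.coe_subset.2 (Finset.filter_subset _ _)))] at h3
    have h4 := Finset.card_filter_add_card_filter_not (s := Λ)
      (fun i => (f R - y₀) * (i - x₀) ^ 2 = k * (R - x₀))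
    have hρ : f R - y₀ ≠ 0 ∨ R - x₀ ≠ 0 := by
      by_contra! h
      exact hR2 (sub_eq_zero.1 h.2) (sub_eq_zero.1 h.1)
    have h5 : (Λ.filter fun i => (f R - y₀) * (i - x₀) ^ 2 = k * (R - x₀)).card ≤ 2 := by
      by_cases h : f R - y₀ = 0
      · have hR0 := hρ.resolve_left (not_not.2 h)
        rw [Finset.filter_false_of_mem]
        · simp
        · intro i _
          rw [h, zero_mul]
          exact (mul_ne_zero hk hR0).symm
      · exact card_filter_mul_sq_eq_le_two Λ h
    change Λ.card + (Λ.filter fun i => ¬ (f R - y₀) * (i - x₀) ^ 2 = k * (R - x₀)).card ≤ _ at h3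
    omega
  have hx₀ : f x₀ = y₀ := by
    rcases hmain x₀ with h | h
    · simp at h
      exact absurd h.symm hk
    · exact h.2
  refine ⟨x₀, k, hk, fun x hx => ?_⟩
  rw [hx₀]
  exact (hmain x).resolve_right fun h => hx h.1

end Hyperbola

/-! ### The bound for graphs and the case of equality -/

section Extremal

variable {F : Type*} [Field F] [Fintype F] [DecidableEq F]

omit [DecidableEq F] in
lemma two_ne_zero_of_odd_card (hq : Odd (Fintype.card F)) : (2 : F) ≠ 0 := by
  refine Ring.two_ne_zero fun h => ?_
  have := FiniteField.even_card_of_char_two h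
  rw [Nat.odd_iff] at hq
  omega

lemma mult_zero_of_injective {f : F → F} (hf : Function.Injective f) (c : F) :
    mult f (0, c) = 2 := by
  obtain ⟨i, rfl⟩ := (Finite.injective_iff_surjective.1 hf) c
  have : (Finset.univ.filter fun j => f j = f i) = {i} := by
    ext j; simp [hf.eq_iff]
  simp [mult, graphMult, this]

/-- The number of lines of nonzero slope through the point over `i` that contain exactly three
points of the graph. -/
def trisecantCount (f : F → F) (i : F) : ℕ :=
  ((Finset.univ.erase 0).filter fun m => chordCount f i m = 2).card

lemma card_chordCount_eq_zero {f : F → F} (hf : Function.Injective f)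
    (h3 : ∀ l, mult f l ≤ 3) (i : F) :
    ((Finset.univ.erase 0).filter fun m => chordCount f i m = 0).card = trisecantCount f i := by
  have h : ∑ m ∈ Finset.univ.erase (0 : F), (chordCount f i m +
        if chordCount f i m = 0 then 1 else 0)
      = ∑ m ∈ Finset.univ.erase (0 : F), (1 + if chordCount f i m = 2 then 1 else 0) := by
    refine Finset.sum_congr rfl fun m hm => ?_
    have h1 := h3 (m, f i - m * i)
    rw [mult_of_ne_zero f (Finset.ne_of_mem_erase hm), graphMult_eq_chordCount] at h1
    have h2 : chordCount f i m ≤ 2 := by omega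
    generalize chordCount f i m = n at h2
    interval_cases n <;> simp
  rw [Finset.sum_add_distrib, Finset.sum_add_distrib, sum_chordCount hf, ← Finset.card_filter,
    ← Finset.card_filter, ← Finset.card_eq_sum_ones] at h
  exact Nat.add_left_cancel h

lemma one_le_trisecantCount (h2 : (2 : F) ≠ 0) {f : F → F} (hf : Function.Injective f)
    (h3 : ∀ l, mult f l ≤ 3) (i : F) : 1 ≤ trisecantCount f i := by
  obtain ⟨m, hm, h⟩ := exists_chordCount_eq_zero h2 hf i
  rw [← card_chordCount_eq_zero hf h3]
  exact Finset.card_pos.2 ⟨m, by simp [hm, h]⟩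

lemma exists_isLight {f : F → F} (hf : Function.Injective f)
    (h3 : ∀ l, mult f l ≤ 3) {i : F} (h1 : trisecantCount f i = 1) : ∃ σ, IsLight f i σ := by
  have h0 := card_chordCount_eq_zero hf h3 i
  rw [h1] at h0
  obtain ⟨τ, hτ⟩ := Finset.card_eq_one.1 h0
  obtain ⟨σ, hσ⟩ := Finset.card_eq_one.1 h1
  have hτ' : ∀ m, (m ≠ 0 ∧ chordCount f i m = 0) ↔ m = τ := fun m => by
    have := Finset.ext_iff.1 hτ m; simpa using this
  have hσ' : ∀ m, (m ≠ 0 ∧ chordCount f i m = 2) ↔ m = σ := fun m => by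
    have := Finset.ext_iff.1 hσ m; simpa using this
  obtain ⟨hτ0, hτ1⟩ := (hτ' τ).2 rfl
  obtain ⟨hσ0, hσ1⟩ := (hσ' σ).2 rfl
  refine ⟨σ, isLight_of_double hf hσ0 hτ0 (fun h => by rw [h, hσ1] at hτ1; omega) ?_⟩
  intro m hm
  have h2 := h3 (m, f i - m * i)
  rw [mult_of_ne_zero f hm, graphMult_eq_chordCount] at h2
  split_ifs with h4 h5
  · rw [h4, hσ1]
  · rw [h5, hτ1]
  · have h6 : chordCount f i m ≠ 0 := fun h => h5 ((hτ' m).1 ⟨hm, h⟩)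
    have h7 : chordCount f i m ≠ 2 := fun h => h4 ((hσ' m).1 ⟨hm, h⟩)
    omega

/-- Double counting of the incidences between the graph and the lines with three points. -/
lemma sum_trisecantCount {f : F → F} (hf : Function.Injective f) :
    ∑ i, trisecantCount f i = 3 * (Finset.univ.filter fun l => mult f l = 3).card := by
  have h1 : ∀ i, trisecantCount f i
      = ∑ m ∈ Finset.univ.erase 0, if graphMult f (m, f i - m * i) = 3 then 1 else 0 := by
    intro i
    rw [trisecantCount, Finset.card_filter]
    refine Finset.sum_congr rfl fun m _ => ?_
    simp [graphMult_eq_chordCount]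
  have h2 : ∀ m, (∑ i, if graphMult f (m, f i - m * i) = 3 then 1 else 0)
      = ∑ c, if graphMult f (m, c) = 3 then 3 else 0 := by
    intro m
    rw [← Finset.sum_fiberwise_of_maps_to' (s := Finset.univ) (t := Finset.univ)
      (g := fun i => f i - m * i) (f := fun c => if graphMult f (m, c) = 3 then 1 else 0)
      (fun _ _ => Finset.mem_univ _)]
    refine Finset.sum_congr rfl fun c _ => ?_
    rw [Finset.sum_const, smul_eq_mul]
    have : (Finset.univ.filter fun i => f i - m * i = c).card = graphMult f (m, c) := by
      rw [graphMult]
      congr 1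
      ext i
      simp [sub_eq_iff_eq_add, add_comm]
    rw [this]
    split_ifs with h <;> simp [h]
  simp_rw [h1]
  rw [Finset.sum_comm, Finset.sum_congr rfl fun m _ => h2 m, Finset.card_filter,
    Fintype.sum_prod_type, Finset.mul_sum, ← Finset.add_sum_erase _ _ (Finset.mem_univ (0 : F))]
  rw [Finset.sum_eq_zero (s := Finset.univ)
    (f := fun y => if mult f ((0 : F), y) = 3 then 1 else 0), mul_zero, zero_add]
  · refine Finset.sum_congr rfl fun m hm => ?_
    rw [Finset.mul_sum]
    refine Finset.sum_congr rfl fun c _ => ?_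
    rw [mult_of_ne_zero f (Finset.ne_of_mem_erase hm)]
    split_ifs <;> simp
  · intro c _
    rw [mult_zero_of_injective hf]
    simp

lemma card_trisecants {f : F → F} (h3 : ∀ l, mult f l ≤ 3) :
    Fintype.card F ^ 2 + Fintype.card F + (oddLines f).card
      = 2 * (metLines f).card + 2 * (Finset.univ.filter fun l => mult f l = 3).card := by
  have h : ∑ l, (mult f l + if Odd (mult f l) then 1 else 0)
      = ∑ l, (2 * (if mult f l ≠ 0 then 1 else 0) + 2 * if mult f l = 3 then 1 else 0) := by
    refine Finset.sum_congr rfl fun l _ => ?_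
    have := h3 l
    generalize mult f l = n at this
    interval_cases n <;> decide
  rw [Finset.sum_add_distrib, Finset.sum_add_distrib, sum_mult, ← Finset.mul_sum, ← Finset.mul_sum,
    ← Finset.card_filter, ← Finset.card_filter, ← Finset.card_filter] at h
  exact h

/-- Most points lie on a single line with three points, by averaging. -/
lemma card_light {f : F → F} (h2 : (2 : F) ≠ 0) (hf : Function.Injective f)
    (h3 : ∀ l, mult f l ≤ 3)
    (ht : 2 * (Finset.univ.filter fun l => mult f l = 3).card + 1 = Fintype.card F) :
    Fintype.card F + 3 ≤ 2 * (Finset.univ.filter fun i => trisecantCount f i = 1).card := by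
  have h : ∑ _i : F, 2 ≤ ∑ i, (trisecantCount f i + if trisecantCount f i = 1 then 1 else 0) := by
    refine Finset.sum_le_sum fun i _ => ?_
    have := one_le_trisecantCount h2 hf h3 i
    split_ifs <;> omega
  rw [Finset.sum_add_distrib, sum_trisecantCount hf, ← Finset.card_filter] at h
  simp at h
  omega

lemma graph_eq_hyperbola_of_card_eq_three (hq : Fintype.card F = 3) {f : F → F}
    (hf : Function.Injective f) :
    ∃ x₀ k : F, k ≠ 0 ∧ ∀ x ≠ x₀, (x - x₀) * (f x - f x₀) = k := by
  have hsq : ∀ x : F, x ≠ 0 → x ^ 2 = 1 := by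
    intro x hx
    have := FiniteField.pow_card_sub_one_eq_one x hx
    rwa [hq] at this
  have hg : ∀ x : F, x ≠ 0 → f x - f 0 ≠ 0 := fun x hx => sub_ne_zero.2 (hf.ne hx)
  refine ⟨0, f 1 - f 0, hg 1 one_ne_zero, fun x hx => ?_⟩
  rw [sub_zero]
  rcases sq_eq_sq_iff_eq_or_eq_neg.1 ((hsq x hx).trans (one_pow 2).symm) with h | h
  · rw [h, one_mul]
  · by_cases h1 : x = 1
    · rw [h1, one_mul]
    · have h4 := (hsq _ (hg x hx)).trans (hsq _ (hg 1 one_ne_zero)).symm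
      rcases sq_eq_sq_iff_eq_or_eq_neg.1 h4 with h5 | h5
      · exact absurd (hf (sub_left_inj.1 h5)) h1
      · rw [h5, h]; ring

/-- The lower bound for the number of met lines. -/
theorem le_card_metLines (hq : Odd (Fintype.card F)) (f : F → F)
    (htan : Function.Injective f ∨ ∀ i, ∃ m, mult f (m, f i - m * i) = 1) :
    Fintype.card F ^ 2 + 2 * Fintype.card F ≤ 2 * (metLines f).card + 1 := by
  have htan' : ∀ i, ∃ m, mult f (m, f i - m * i) = 1 :=
    htan.elim (fun h => exists_tangent_of_injective (two_ne_zero_of_odd_card hq) h) id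
  have h1 := (le_card_oddLines_erase hq f htan' 0).trans (Finset.card_erase_le)
  have h2 := card_oddLines_le f
  have := hq.pos
  omega

/-- If the bound is attained, the graph consists of a hyperbola with horizontal and vertical
asymptotes and of its centre. -/
theorem graph_eq_hyperbola_of_card_metLines (hq : Odd (Fintype.card F)) (f : F → F)
    (htan : Function.Injective f ∨ ∀ i, ∃ m, mult f (m, f i - m * i) = 1)
    (heq : 2 * (metLines f).card + 1 = Fintype.card F ^ 2 + 2 * Fintype.card F) :
    ∃ x₀ k : F, k ≠ 0 ∧ ∀ x ≠ x₀, (x - x₀) * (f x - f x₀) = k := by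
  have h2 := two_ne_zero_of_odd_card hq
  have htan' : ∀ i, ∃ m, mult f (m, f i - m * i) = 1 :=
    htan.elim (fun h => exists_tangent_of_injective h2 h) id
  have hge := (le_card_oddLines_erase hq f htan' 0).trans (Finset.card_erase_le)
  have hle := card_oddLines_le f
  have hpos := hq.pos
  have hf : Function.Injective f := by
    rw [Finite.injective_iff_surjective]
    by_contra hf
    have := le_card_oddLines_of_not_surjective hq f htan' hf
    omega
  by_cases hq5 : 5 ≤ Fintype.card F
  · have h3 := mult_le_three_of_card_eq f (by omega)
    have ht := card_trisecants h3
    have hl := card_light h2 hf h3 (by omega)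
    have hex : ∀ i, ∃ σ, i ∈ (Finset.univ.filter fun i => trisecantCount f i = 1) →
        IsLight f i σ := by
      intro i
      by_cases hi : trisecantCount f i = 1
      · obtain ⟨σ, hσ⟩ := exists_isLight hf h3 hi
        exact ⟨σ, fun _ => hσ⟩
      · exact ⟨0, fun h => absurd (by simpa using h) hi⟩
    choose σ hσ using hex
    exact graph_eq_hyperbola_of_light hf h2 _ hq5 hl σ hσ
  · refine graph_eq_hyperbola_of_card_eq_three ?_ hf
    have := Fintype.one_lt_card (α := F)
    obtain ⟨r, hr⟩ := hq
    omega

/-- If no line contains three points of the graph, the horizontal lines with exactly one point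
number exactly one: for each slope the number of such lines is odd, and in total there are `q`. -/
theorem card_metLines_of_arc (hq : Odd (Fintype.card F)) (f : F → F)
    (harc : ∀ l, graphMult f l ≤ 2) :
    2 * (metLines f).card + 1 = Fintype.card F ^ 2 + 2 * Fintype.card F := by
  set u : F → ℕ := fun m => (Finset.univ.filter fun c => graphMult f (m, c) = 1).card with hu
  have hpt : ∀ l, graphMult f l ^ 2 + (if graphMult f l = 1 then 1 else 0) = 2 * graphMult f l := by
    intro l
    have := harc l
    generalize graphMult f l = n at this
    interval_cases n <;> simp
  have hsum : ∑ m, u m = Fintype.card F := by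
    have h1 := Finset.sum_congr rfl fun l (_ : l ∈ (Finset.univ : Finset (F × F))) => hpt l
    rw [Finset.sum_add_distrib, ← Finset.mul_sum, sum_graphMult] at h1
    have h2 := sum_graphMult_sq f
    have h3 : ∑ m, u m = ∑ l : F × F, if graphMult f l = 1 then 1 else 0 := by
      rw [Fintype.sum_prod_type]
      simp [hu]
    omega
  have hodd : ∀ m, 1 ≤ u m := by
    intro m
    by_contra! h
    have h0 : ∀ c, graphMult f (m, c) ≠ 1 := by
      have : u m = 0 := by omega
      simpa [hu, Finset.filter_eq_empty_iff] using this
    have := Finset.even_sum (s := Finset.univ) (fun c => graphMult f (m, c)) (by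
      intro c _
      have h1 := harc (m, c)
      have h2 := h0 c
      have : graphMult f (m, c) = 0 ∨ graphMult f (m, c) = 2 := by omega
      rcases this with h | h <;> rw [h] <;> decide)
    rw [sum_graphMult_slope] at this
    exact (Nat.not_even_iff_odd.2 hq) this
  have hone : u 0 = 1 := by
    have h1 := (Finset.sum_eq_sum_iff_of_le (s := Finset.univ) (fun m _ => hodd m)).1
      (by rw [hsum]; simp)
    exact (h1 0 (Finset.mem_univ _)).symm
  -- all horizontal lines are met; the others are counted by `2 [n > 0] = n + [n = 1]`
  have hmet : ∑ l, (2 * (if mult f l ≠ 0 then 1 else 0)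
        + if l.1 = 0 then graphMult f (0, l.2) + (if graphMult f (0, l.2) = 1 then 1 else 0) else 0)
      = ∑ l, (graphMult f l + (if graphMult f l = 1 then 1 else 0)
        + if l.1 = 0 then 2 else 0) := by
    refine Finset.sum_congr rfl fun l _ => ?_
    obtain ⟨m, c⟩ := l
    by_cases hm : m = 0
    · subst hm
      simp [mult]
      ring
    · have := harc (m, c)
      rw [mult_of_ne_zero f hm]
      generalize graphMult f (m, c) = n at this
      simp only [hm, if_false]
      interval_cases n <;> decide
  rw [Finset.sum_add_distrib, Finset.sum_add_distrib, Finset.sum_add_distrib, sum_graphMult,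
    ← Finset.mul_sum, sum_horizontal (fun c => graphMult f (0, c) +
      (if graphMult f (0, c) = 1 then 1 else 0)), sum_horizontal (fun _ => 2),
    Finset.sum_add_distrib, sum_graphMult_slope, ← Finset.card_filter, ← Finset.card_filter,
    ← Finset.card_filter] at hmet
  have h3 : ∑ m, u m = (Finset.univ.filter fun l : F × F => graphMult f l = 1).card := by
    rw [Finset.card_filter, Fintype.sum_prod_type]
    simp [hu]
  have h4 : (Finset.univ.filter fun c => graphMult f (0, c) = 1).card = 1 := hone
  rw [h4, ← h3, hsum] at hmet
  simp at hmet
  simp only [metLines]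
  simp only [ne_eq]
  omega

end Extremal

/-! ### Coordinate frames -/

section Frames

variable {F : Type*} [Field F]

open Projectivization in
lemma mk_mem_mk {v w : Fin 3 → F} (hv : v ≠ 0) (hw : w ≠ 0) :
    (mk F v hv : Point F) ∈ (mk F w hw : Line F) ↔ v ⬝ᵥ w = 0 :=
  orthogonal_mk hv hw

lemma mem_iff_rep (P : Point F) (l : Line F) : P ∈ l ↔ P.rep ⬝ᵥ l.rep = 0 := by
  conv_lhs => rw [← P.mk_rep, ← l.mk_rep]
  exact mk_mem_mk _ _

lemma mem_mk_iff (P : Point F) {w : Fin 3 → F} (hw : w ≠ 0) :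
    P ∈ (Projectivization.mk F w hw : Line F) ↔ P.rep ⬝ᵥ w = 0 := by
  conv_lhs => rw [← P.mk_rep]
  exact mk_mem_mk _ _

lemma mk_mem_iff {v : Fin 3 → F} (hv : v ≠ 0) (l : Line F) :
    (Projectivization.mk F v hv : Point F) ∈ l ↔ v ⬝ᵥ l.rep = 0 := by
  conv_lhs => rw [← l.mk_rep]
  exact mk_mem_mk _ _

/-- Two bases of `F³` dual to each other for the dot product: a coordinate frame of the plane
(for points) and the corresponding frame for lines. -/
def DualBases (v v' : Fin 3 → Fin 3 → F) : Prop :=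
  ∀ i j, v i ⬝ᵥ v' j = if i = j then 1 else 0

namespace DualBases

variable {v v' : Fin 3 → Fin 3 → F}

lemma symm (h : DualBases v v') : DualBases v' v := fun i j => by
  rw [dotProduct_comm, h j i]
  simp [eq_comm]

lemma mul_transpose (h : DualBases v v') :
    (Matrix.of v) * (Matrix.of v').transpose = 1 := by
  ext i j
  rw [Matrix.mul_apply, Matrix.one_apply]
  exact h i j

lemma sum_mul (h : DualBases v v') (i l : Fin 3) :
    ∑ j, v' j i * v j l = if i = l then 1 else 0 := by
  have h1 := congrFun (congrFun (show (Matrix.of v').transpose * Matrix.of v = 1 from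
    mul_eq_one_comm.1 h.mul_transpose) i) l
  rw [Matrix.mul_apply, Matrix.one_apply] at h1
  exact h1

lemma expand (h : DualBases v v') (x : Fin 3 → F) :
    x = (x ⬝ᵥ v' 0) • v 0 + (x ⬝ᵥ v' 1) • v 1 + (x ⬝ᵥ v' 2) • v 2 := by
  ext l
  have h1 : ∀ i, x i * (∑ j, v' j i * v j l) = if i = l then x i else 0 := fun i => by
    rw [h.sum_mul i l]; simp
  have h2 : x l = ∑ i, x i * (∑ j, v' j i * v j l) := by
    simp_rw [h1]; simp
  rw [h2]
  simp [dotProduct, Fin.sum_univ_three]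
  ring

lemma ext_dot (h : DualBases v v') {x y : Fin 3 → F} (h0 : x ⬝ᵥ v' 0 = y ⬝ᵥ v' 0)
    (h1 : x ⬝ᵥ v' 1 = y ⬝ᵥ v' 1) (h2 : x ⬝ᵥ v' 2 = y ⬝ᵥ v' 2) : x = y := by
  rw [h.expand x, h.expand y, h0, h1, h2]

lemma ne_zero (h : DualBases v v') (i : Fin 3) : v i ≠ 0 := by
  intro h0
  have := h i i
  simp [h0] at this

/-- A coordinate vector of the affine point `(x, y)`: `v 2` is the origin, and `v 1`,
`v 0` are the points at infinity of the horizontal and the vertical axis. -/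
def vec (v : Fin 3 → Fin 3 → F) (x y : F) : Fin 3 → F := v 2 + x • v 1 + y • v 0

/-- The coordinate vector of the line `y = m * x + c`. -/
def lvec (v' : Fin 3 → Fin 3 → F) (m c : F) : Fin 3 → F := c • v' 2 + m • v' 1 - v' 0

lemma vec_dot_zero (h : DualBases v v') (x y : F) : vec v x y ⬝ᵥ v' 0 = y := by
  simp [vec, h _ _]

lemma vec_dot_one (h : DualBases v v') (x y : F) : vec v x y ⬝ᵥ v' 1 = x := by
  simp [vec, h _ _]

lemma vec_dot_two (h : DualBases v v') (x y : F) : vec v x y ⬝ᵥ v' 2 = 1 := by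
  simp [vec, h _ _]

lemma vec_ne_zero (h : DualBases v v') (x y : F) : vec v x y ≠ 0 := by
  intro h0
  have := h.vec_dot_two x y
  simp [h0] at this

lemma vec_dot (v : Fin 3 → Fin 3 → F) (x y : F) (w : Fin 3 → F) :
    vec v x y ⬝ᵥ w = v 2 ⬝ᵥ w + x * (v 1 ⬝ᵥ w) + y * (v 0 ⬝ᵥ w) := by
  simp [vec]

lemma dot_lvec_zero (h : DualBases v v') (m c : F) : v 0 ⬝ᵥ lvec v' m c = -1 := by
  simp [lvec, h _ _]

lemma dot_lvec_one (h : DualBases v v') (m c : F) : v 1 ⬝ᵥ lvec v' m c = m := by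
  simp [lvec, h _ _]

lemma dot_lvec_two (h : DualBases v v') (m c : F) : v 2 ⬝ᵥ lvec v' m c = c := by
  simp [lvec, h _ _]

lemma lvec_ne_zero (h : DualBases v v') (m c : F) : lvec v' m c ≠ 0 := by
  intro h0
  have := h.dot_lvec_zero m c
  simp [h0] at this

/-- The basis points of a frame. -/
def base (h : DualBases v v') (i : Fin 3) : Point F := Projectivization.mk F (v i) (h.ne_zero i)

/-- The point with affine coordinates `(x, y)` in a frame. -/
def aff (h : DualBases v v') (x y : F) : Point F :=
  Projectivization.mk F (vec v x y) (h.vec_ne_zero x y)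

/-- The line `y = m * x + c` in a frame. -/
def line (h : DualBases v v') (l : F × F) : Line F :=
  Projectivization.mk F (lvec v' l.1 l.2) (h.lvec_ne_zero l.1 l.2)

lemma base_zero_notMem_line (h : DualBases v v') (l : F × F) : h.base 0 ∉ h.line l := by
  rw [base, line, mk_mem_mk, h.dot_lvec_zero]
  simp

lemma base_one_mem_line (h : DualBases v v') (l : F × F) : h.base 1 ∈ h.line l ↔ l.1 = 0 := by
  rw [base, line, mk_mem_mk, h.dot_lvec_one]

lemma aff_mem_line (h : DualBases v v') (x y : F) (l : F × F) :
    h.aff x y ∈ h.line l ↔ y = l.1 * x + l.2 := by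
  rw [aff, line, mk_mem_mk, vec_dot, h.dot_lvec_zero, h.dot_lvec_one, h.dot_lvec_two]
  constructor <;> intro h <;> linear_combination -h

lemma aff_inj (h : DualBases v v') {x y x₁ y₁ : F} (he : h.aff x y = h.aff x₁ y₁) :
    x = x₁ ∧ y = y₁ := by
  rw [aff, aff, Projectivization.mk_eq_mk_iff'] at he
  obtain ⟨a, ha⟩ := he
  have h2 := congrArg (· ⬝ᵥ v' 2) ha
  have h1 := congrArg (· ⬝ᵥ v' 1) ha
  have h0 := congrArg (· ⬝ᵥ v' 0) ha
  simp only [smul_dotProduct, h.vec_dot_zero, h.vec_dot_one, h.vec_dot_two, smul_eq_mul] at h0 h1 h2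
  rw [mul_one] at h2
  rw [h2, one_mul] at h0 h1
  exact ⟨h1.symm, h0.symm⟩

lemma line_injective (h : DualBases v v') : Function.Injective h.line := by
  rintro ⟨m, c⟩ ⟨m₁, c₁⟩ he
  rw [line, line, Projectivization.mk_eq_mk_iff'] at he
  obtain ⟨a, ha⟩ := he
  have h0 := congrArg (v 0 ⬝ᵥ ·) ha
  have h1 := congrArg (v 1 ⬝ᵥ ·) ha
  have h2 := congrArg (v 2 ⬝ᵥ ·) ha
  simp only [dotProduct_smul, h.dot_lvec_zero, h.dot_lvec_one, h.dot_lvec_two, smul_eq_mul]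
    at h0 h1 h2
  have ha1 : a = 1 := by linear_combination -h0
  rw [ha1, one_mul] at h1 h2
  rw [h1, h2]

lemma base_ne_aff (h : DualBases v v') {i : Fin 3} (hi : i ≠ 2) (x y : F) :
    h.base i ≠ h.aff x y := by
  intro he
  rw [base, aff, Projectivization.mk_eq_mk_iff'] at he
  obtain ⟨a, ha⟩ := he
  have h2 := congrArg (· ⬝ᵥ v' 2) ha
  simp only [smul_dotProduct, h.vec_dot_two, h i 2, hi] at h2
  simp at h2
  rw [h2, zero_smul] at ha
  exact h.ne_zero i ha.symm

lemma base_injective (h : DualBases v v') : Function.Injective h.base := by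
  intro i j he
  rw [base, base, Projectivization.mk_eq_mk_iff'] at he
  obtain ⟨a, ha⟩ := he
  by_contra hij
  have h2 := congrArg (· ⬝ᵥ v' i) ha
  simp only [smul_dotProduct, h j i, h i i, if_neg (Ne.symm hij)] at h2
  simp at h2

lemma aff_zero (h : DualBases v v') : h.aff 0 0 = h.base 2 := by
  simp [aff, base, vec]

lemma eq_aff (h : DualBases v v') {P : Point F} (hP : P.rep ⬝ᵥ v' 2 ≠ 0) :
    P = h.aff (P.rep ⬝ᵥ v' 1 / P.rep ⬝ᵥ v' 2) (P.rep ⬝ᵥ v' 0 / P.rep ⬝ᵥ v' 2) := by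
  conv_lhs => rw [← P.mk_rep]
  rw [aff, Projectivization.mk_eq_mk_iff']
  refine ⟨P.rep ⬝ᵥ v' 2, ?_⟩
  apply h.ext_dot <;>
  simp only [smul_dotProduct, h.vec_dot_zero, h.vec_dot_one, h.vec_dot_two, smul_eq_mul] <;>
  field_simp

lemma eq_base (h : DualBases v v') {P : Point F} {i : Fin 3}
    (hP : ∀ j ≠ i, P.rep ⬝ᵥ v' j = 0) : P = h.base i := by
  conv_lhs => rw [← P.mk_rep]
  rw [base, Projectivization.mk_eq_mk_iff']
  refine ⟨P.rep ⬝ᵥ v' i, ?_⟩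
  have key : ∀ j, ((P.rep ⬝ᵥ v' i) • v i) ⬝ᵥ v' j = P.rep ⬝ᵥ v' j := by
    intro j
    rw [smul_dotProduct, h i j, smul_eq_mul]
    by_cases hj : i = j
    · subst hj; simp
    · rw [if_neg hj, hP j (Ne.symm hj), mul_zero]
  exact h.ext_dot (key 0) (key 1) (key 2)

lemma exists_eq_line (h : DualBases v v') {l : Line F} (hl : h.base 0 ∉ l) :
    ∃ m, l = h.line m := by
  rw [base, mk_mem_iff] at hl
  refine ⟨(-(v 1 ⬝ᵥ l.rep) / (v 0 ⬝ᵥ l.rep), -(v 2 ⬝ᵥ l.rep) / (v 0 ⬝ᵥ l.rep)), ?_⟩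
  conv_lhs => rw [← l.mk_rep]
  rw [line, Projectivization.mk_eq_mk_iff']
  refine ⟨-(v 0 ⬝ᵥ l.rep), ?_⟩
  apply h.symm.ext_dot <;>
  simp only [dotProduct_smul, dotProduct_comm _ (v _), h.dot_lvec_zero, h.dot_lvec_one,
    h.dot_lvec_two, smul_eq_mul] <;>
  field_simp

/-- Moving the origin of a frame to the point `(x₀, y₀)`. -/
lemma translate (h : DualBases v v') (x₀ y₀ : F) :
    DualBases ![v 0, v 1, vec v x₀ y₀] ![v' 0 - y₀ • v' 2, v' 1 - x₀ • v' 2, v' 2] := by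
  intro i j
  fin_cases i <;> fin_cases j <;> simp [h _ _, h.vec_dot_zero, h.vec_dot_one, h.vec_dot_two]

lemma translate_aff (h : DualBases v v') (x₀ y₀ x y : F) :
    (h.translate x₀ y₀).aff x y = h.aff (x₀ + x) (y₀ + y) := by
  unfold aff
  congr 1
  ext i
  simp [vec]
  ring

end DualBases

lemma exists_dualBases (P Q : Point F) (hPQ : P ≠ Q) :
    ∃ (v v' : Fin 3 → Fin 3 → F) (h : DualBases v v'), h.base 0 = P ∧ h.base 1 = Q := by
  have hlin := Projectivization.linearIndependent_pair_iff_ne.2 hPQ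
  obtain ⟨w, hw⟩ := exists_linearIndependent_snoc_of_lt_finrank hlin (by simp)
  set v : Fin 3 → Fin 3 → F := Fin.snoc ![P.rep, Q.rep] w with hv
  have hv0 : v 0 = P.rep := rfl
  have hv1 : v 1 = Q.rep := rfl
  have hunit : IsUnit (Matrix.of v) := Matrix.linearIndependent_rows_iff_isUnit.1 hw
  have hdet : IsUnit (Matrix.of v).det := (Matrix.isUnit_iff_isUnit_det _).1 hunit
  have h : DualBases v (fun j i => (Matrix.of v)⁻¹ i j) := by
    intro i j
    have := congrFun (congrFun (Matrix.mul_nonsing_inv _ hdet) i) j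
    rw [Matrix.mul_apply, Matrix.one_apply] at this
    exact this
  refine ⟨v, _, h, ?_, ?_⟩
  · exact P.mk_rep
  · exact Q.mk_rep

end Frames

/-! ### Sets with an internal nucleus -/

section Nucleus

variable {F : Type*} [Field F]

/-- In a frame whose vertical point at infinity is the internal nucleus and whose horizontal point
at infinity belongs to `Ω`, the rest of `Ω` is the graph of a function. -/
lemma IsInternalNucleus.exists_graph {Ω : Set (Point F)} {N Q : Point F}
    (hN : IsInternalNucleus Ω N) (hQ : Q ∈ Ω) (hNQ : N ≠ Q) :
    ∃ (v v' : Fin 3 → Fin 3 → F) (h : DualBases v v') (f : F → F),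
      h.base 0 = N ∧ h.base 1 = Q ∧ ∀ P, P ∈ Ω ↔ P = N ∨ P = Q ∨ ∃ x, P = h.aff x (f x) := by
  obtain ⟨v, v', h, h0, h1⟩ := exists_dualBases N Q hNQ
  have hne : ∀ x : F, v' 1 - x • v' 2 ≠ 0 := by
    intro x hx
    have := congrArg (v 1 ⬝ᵥ ·) hx
    simp [h _ _] at this
  let vert : F → Line F := fun x => Projectivization.mk F _ (hne x)
  have hvert : ∀ x, N ∈ vert x := by
    intro x
    rw [← h0, DualBases.base, mk_mem_mk]
    simp [h _ _]
  have hmem : ∀ (P : Point F) x, P ∈ vert x ↔ P.rep ⬝ᵥ v' 1 = x * (P.rep ⬝ᵥ v' 2) := by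
    intro P x
    rw [mem_mk_iff]
    simp [sub_eq_zero]
  have hex : ∀ x, ∃ y, h.aff x y ∈ Ω ∧ h.aff x y ∈ vert x := by
    intro x
    obtain ⟨P, ⟨hP1, hP2, hP3⟩, -⟩ := hN.2 _ (hvert x)
    have hP4 := (hmem P x).1 hP3
    have hP5 : P.rep ⬝ᵥ v' 2 ≠ 0 := by
      intro h5
      refine hP2 (h0 ▸ h.eq_base fun j hj => ?_)
      rw [h5, mul_zero] at hP4
      fin_cases j
      · exact absurd rfl hj
      · exact hP4
      · exact h5
    have hP6 := h.eq_aff hP5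
    rw [hP4, mul_div_cancel_right₀ _ hP5] at hP6
    exact ⟨_, hP6 ▸ hP1, hP6 ▸ hP3⟩
  choose f hf using hex
  refine ⟨v, v', h, f, h0, h1, fun P => ⟨fun hP => ?_, ?_⟩⟩
  · by_cases hPN : P = N
    · exact Or.inl hPN
    right
    by_cases hP2 : P.rep ⬝ᵥ v' 2 = 0
    · left
      have hinf : ∀ R : Point F, R.rep ⬝ᵥ v' 2 = 0 →
          R ∈ (Projectivization.mk F (v' 2) (h.symm.ne_zero 2) : Line F) := fun R hR =>
        (mem_mk_iff R _).2 hR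
      refine (hN.2 (Projectivization.mk F (v' 2) (h.symm.ne_zero 2)) ?_).unique
        ⟨hP, hPN, hinf P hP2⟩ ⟨hQ, hNQ.symm, ?_⟩
      · rw [← h0, DualBases.base, mk_mem_mk, h]; simp
      · rw [← h1, DualBases.base, mk_mem_mk, h]; simp
    · right
      refine ⟨P.rep ⬝ᵥ v' 1 / P.rep ⬝ᵥ v' 2, ?_⟩
      refine (hN.2 _ (hvert (P.rep ⬝ᵥ v' 1 / P.rep ⬝ᵥ v' 2))).unique ⟨hP, hPN, ?_⟩
        ⟨(hf _).1, ?_, (hf _).2⟩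
      · rw [hmem]; field_simp
      · rw [← h0]
        exact (h.base_ne_aff (by decide) _ _).symm
  · rintro (rfl | rfl | ⟨x, rfl⟩)
    · exact hN.1
    · exact hQ
    · exact (hf x).1

open Classical in
/-- Lines off the nucleus that meet `Ω` correspond to the lines of the affine plane that meet the
graph or are horizontal. -/
lemma ncard_linesMeeting_sdiff [Fintype F] {Ω : Set (Point F)} {v v' : Fin 3 → Fin 3 → F}
    (h : DualBases v v') (f : F → F)
    (hΩ : ∀ P, P ∈ Ω ↔ P = h.base 0 ∨ P = h.base 1 ∨ ∃ x, P = h.aff x (f x)) :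
    (linesMeeting Ω \ {l | h.base 0 ∈ l}).ncard = (metLines f).card := by
  have himg : linesMeeting Ω \ {l | h.base 0 ∈ l} = h.line '' (metLines f : Set (F × F)) := by
    ext l
    constructor
    · rintro ⟨⟨P, hP, hPl⟩, hl⟩
      obtain ⟨m, rfl⟩ := h.exists_eq_line hl
      refine ⟨m, ?_, rfl⟩
      rw [Finset.mem_coe, metLines, Finset.mem_filter]
      refine ⟨Finset.mem_univ _, ?_⟩
      rcases (hΩ P).1 hP with rfl | rfl | ⟨x, rfl⟩
      · exact absurd hPl hl
      · rw [mult, if_pos ((h.base_one_mem_line m).1 hPl)]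
        omega
      · rw [h.aff_mem_line] at hPl
        have : graphMult f m ≠ 0 := Finset.card_ne_zero_of_mem (a := x) (by simp [hPl])
        rw [mult]
        omega
    · rintro ⟨m, hm, rfl⟩
      refine ⟨?_, h.base_zero_notMem_line m⟩
      rw [Finset.mem_coe, metLines, Finset.mem_filter, mult] at hm
      by_cases hm0 : m.1 = 0
      · exact ⟨h.base 1, (hΩ _).2 (Or.inr (Or.inl rfl)), (h.base_one_mem_line m).2 hm0⟩
      · rw [if_neg hm0, add_zero] at hm
        obtain ⟨x, hx⟩ := Finset.card_ne_zero.1 hm.2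
        rw [Finset.mem_filter] at hx
        exact ⟨h.aff x (f x), (hΩ _).2 (Or.inr (Or.inr ⟨x, rfl⟩)), (h.aff_mem_line _ _ m).2 hx.2⟩
  rw [himg, Set.ncard_image_of_injective _ h.line_injective, Set.ncard_coe_finset]

lemma exists_line_through (P : Point F) : ∃ l : Line F, P ∈ l := by
  obtain ⟨Q, hQ⟩ : ∃ Q : Point F, P ≠ Q := by
    by_contra! hc
    have hQP : ∀ R : Point F, R = P := fun R => (hc R).symm
    have h1 := hQP (Projectivization.mk F ![1, 0, 0] (by simp))
    have h2 := hQP (Projectivization.mk F ![0, 1, 0] (by simp))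
    have h3 := h1.trans h2.symm
    rw [Projectivization.mk_eq_mk_iff'] at h3
    obtain ⟨a, ha⟩ := h3
    simpa using congrFun ha 0
  obtain ⟨v, v', h, h0, -⟩ := exists_dualBases P Q hQ
  refine ⟨Projectivization.mk F (v' 2) (h.symm.ne_zero 2), ?_⟩
  rw [← h0, DualBases.base, mk_mem_mk, h]
  simp

open Classical in
/-- The frame can be chosen such that the horizontal point at infinity is a second internal nucleus
if there is one; otherwise every point of the graph is on a tangent. -/
lemma IsInternalNucleus.exists_good_graph [Fintype F] {Ω : Set (Point F)} {N : Point F}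
    (hN : IsInternalNucleus Ω N) :
    ∃ (v v' : Fin 3 → Fin 3 → F) (h : DualBases v v') (f : F → F),
      h.base 0 = N ∧ (∀ P, P ∈ Ω ↔ P = h.base 0 ∨ P = h.base 1 ∨ ∃ x, P = h.aff x (f x)) ∧
      (Function.Injective f ∨ ∀ i, ∃ m, mult f (m, f i - m * i) = 1) := by
  by_cases hall : ∀ Q ∈ Ω, Q ≠ N → ∃ l : Line F, N ∉ l ∧ Q ∈ l ∧ ∀ R ∈ Ω, R ∈ l → R = Q
  · obtain ⟨l, hl⟩ := exists_line_through N
    obtain ⟨Q, ⟨hQ, hQN, -⟩, -⟩ := hN.2 l hl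
    obtain ⟨v, v', h, f, rfl, rfl, hΩ⟩ := hN.exists_graph hQ hQN.symm
    refine ⟨v, v', h, f, rfl, hΩ, Or.inr fun i => ?_⟩
    obtain ⟨t, ht0, ht1, ht2⟩ := hall (h.aff i (f i)) ((hΩ _).2 (Or.inr (Or.inr ⟨i, rfl⟩)))
      (h.base_ne_aff (by decide) _ _).symm
    obtain ⟨⟨m, c⟩, rfl⟩ := h.exists_eq_line ht0
    have hm : m ≠ 0 := fun hm => h.base_ne_aff (by decide) _ _
      (ht2 _ hQ ((h.base_one_mem_line _).2 hm))
    rw [h.aff_mem_line] at ht1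
    have hc : f i - m * i = c := by rw [ht1]; ring
    refine ⟨m, ?_⟩
    rw [hc, mult_of_ne_zero f hm, graphMult, Finset.card_eq_one]
    refine ⟨i, ?_⟩
    ext j
    rw [Finset.mem_filter, Finset.mem_singleton]
    constructor
    · rintro ⟨-, hj⟩
      exact (h.aff_inj (ht2 (h.aff j (f j)) ((hΩ _).2 (Or.inr (Or.inr ⟨j, rfl⟩)))
        ((h.aff_mem_line _ _ _).2 hj))).1
    · rintro rfl
      exact ⟨Finset.mem_univ _, ht1⟩
  · push Not at hall
    obtain ⟨Q, hQ, hQN, hno⟩ := hall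
    obtain ⟨v, v', h, f, rfl, rfl, hΩ⟩ := hN.exists_graph hQ hQN.symm
    refine ⟨v, v', h, f, rfl, hΩ, Or.inl ?_⟩
    rw [Finite.injective_iff_surjective]
    intro c
    obtain ⟨R, hR, hRl, hRQ⟩ := hno (h.line (0, c)) (h.base_zero_notMem_line _)
      ((h.base_one_mem_line _).2 rfl)
    rcases (hΩ R).1 hR with rfl | rfl | ⟨x, rfl⟩
    · exact absurd hRl (h.base_zero_notMem_line _)
    · exact absurd rfl hRQ
    · rw [h.aff_mem_line] at hRl
      exact ⟨x, by rw [hRl]; simp⟩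

theorem IsInternalNucleus.le_ncard [Finite F] (hq : Odd (Nat.card F)) {Ω : Set (Point F)}
    {N : Point F} (hN : IsInternalNucleus Ω N) :
    Nat.card F ^ 2 + 2 * Nat.card F ≤ 2 * (linesMeeting Ω \ {l | N ∈ l}).ncard + 1 := by
  classical
  have := Fintype.ofFinite F
  rw [Nat.card_eq_fintype_card] at hq ⊢
  obtain ⟨v, v', h, f, rfl, hΩ, hf⟩ := hN.exists_good_graph
  rw [ncard_linesMeeting_sdiff h f hΩ]
  exact le_card_metLines hq f hf

theorem IsInternalNucleus.exists_hyperbola [Finite F] (hq : Odd (Nat.card F)) {Ω : Set (Point F)}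
    {N : Point F} (hN : IsInternalNucleus Ω N)
    (heq : 2 * (linesMeeting Ω \ {l | N ∈ l}).ncard + 1 = Nat.card F ^ 2 + 2 * Nat.card F) :
    ∃ (v v' : Fin 3 → Fin 3 → F) (h : DualBases v v') (k : F), k ≠ 0 ∧ h.base 0 = N ∧
      ∀ P, P ∈ Ω ↔ P = h.base 0 ∨ P = h.base 1 ∨ P = h.base 2 ∨
        ∃ t ≠ 0, P = h.aff t (k / t) := by
  classical
  have := Fintype.ofFinite F
  rw [Nat.card_eq_fintype_card] at hq heq
  obtain ⟨v, v', h, f, rfl, hΩ, hf⟩ := hN.exists_good_graph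
  rw [ncard_linesMeeting_sdiff h f hΩ] at heq
  obtain ⟨x₀, k, hk, hgr⟩ := graph_eq_hyperbola_of_card_metLines hq f hf heq
  refine ⟨_, _, h.translate x₀ (f x₀), k, hk, rfl, fun P => ?_⟩
  have htr := h.translate_aff x₀ (f x₀)
  rw [hΩ, ← DualBases.aff_zero]
  simp only [htr, add_zero]
  have hb0 : (h.translate x₀ (f x₀)).base 0 = h.base 0 := rfl
  have hb1 : (h.translate x₀ (f x₀)).base 1 = h.base 1 := rfl
  have hfx : ∀ x, x ≠ x₀ → f x = f x₀ + k / (x - x₀) := by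
    intro x hx
    have h0 : x - x₀ ≠ 0 := sub_ne_zero.2 hx
    rw [← hgr x hx]
    field_simp
    ring
  rw [hb0, hb1]
  refine or_congr_right (or_congr_right ⟨?_, ?_⟩)
  · rintro ⟨x, rfl⟩
    by_cases hx : x = x₀
    · left; rw [hx]
    · right
      refine ⟨x - x₀, sub_ne_zero.2 hx, ?_⟩
      rw [hfx x hx, add_sub_cancel]
  · rintro (rfl | ⟨t, ht, rfl⟩)
    · exact ⟨x₀, rfl⟩
    · refine ⟨x₀ + t, ?_⟩
      have hx : x₀ + t ≠ x₀ := by simpa using ht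
      rw [hfx _ hx, add_sub_cancel_left]

end Nucleus

/-! ### Irreducibility of the conic -/

section Irreducible

open MvPolynomial

/-- The polynomial `X₁ X₀ - k X₂²` is irreducible. -/
lemma irreducible_X_mul_X_sub {K : Type*} [Field K] {k : K} (hk : k ≠ 0) :
    Irreducible (X 1 * X 0 - C k * X 2 ^ 2 : MvPolynomial (Fin 3) K) := by
  rw [sub_eq_add_neg]
  refine irreducible_mul_X_add (X 1) (-(C k * X 2 ^ 2)) 0 (X_ne_zero 1) ?_ ?_ ?_
  · simp
  · rw [vars_neg]
    intro h
    rcases Finset.mem_union.1 (vars_mul _ _ h) with h1 | h1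
    · simp at h1
    · have h2 := vars_pow (X 2 : MvPolynomial (Fin 3) K) 2 h1
      simp at h2
  · rw [IsRelPrime.neg_right_iff]
    refine (X_prime (i := (1 : Fin 3))).irreducible.isRelPrime_iff_not_dvd.2 ?_
    intro h
    obtain ⟨p, hp⟩ := h
    have := congrArg (eval (fun i : Fin 3 => if i = 2 then (1 : K) else 0)) hp
    simp at this
    exact hk this

/-- Substitution of the linear forms given by the rows of a matrix. -/
noncomputable def linSubst {K : Type*} [Field K] (w : Fin 3 → Fin 3 → K) :
    MvPolynomial (Fin 3) K →ₐ[K] MvPolynomial (Fin 3) K :=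
  aeval fun j => ∑ i, C (w j i) * X i

lemma linSubst_comp {K : Type*} [Field K] {v w : Fin 3 → Fin 3 → K}
    (h : ∀ i l, ∑ j, w i j * v j l = if i = l then 1 else 0) :
    (linSubst v).comp (linSubst w) = AlgHom.id K _ := by
  ext1 i
  have h1 : (linSubst v).comp (linSubst w) (X i) = ∑ l, C (∑ j, w i j * v j l) * X l := by
    simp only [linSubst, AlgHom.comp_apply, aeval_X, map_sum, map_mul, algHom_C, algebraMap_eq,
      Finset.mul_sum, Finset.sum_mul]
    rw [Finset.sum_comm]
    simp only [mul_assoc]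
  rw [h1]
  simp only [h]
  rw [Finset.sum_eq_single i]
  · simp
  · intro l _ hl
    simp [Ne.symm hl]
  · simp

lemma irreducible_linSubst {K : Type*} [Field K] {v w : Fin 3 → Fin 3 → K}
    (h1 : ∀ i l, ∑ j, w i j * v j l = if i = l then 1 else 0)
    (h2 : ∀ i l, ∑ j, v i j * w j l = if i = l then 1 else 0)
    {p : MvPolynomial (Fin 3) K} (hp : Irreducible p) : Irreducible (linSubst w p) := by
  let e : MvPolynomial (Fin 3) K ≃ₐ[K] MvPolynomial (Fin 3) K :=
    AlgEquiv.ofAlgHom (linSubst w) (linSubst v) (linSubst_comp h2) (linSubst_comp h1)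
  exact (MulEquiv.irreducible_iff e.toMulEquiv).2 hp

end Irreducible

/-! ### The conic as a dual oval with an external point -/

section Conic

variable {F : Type*} [Field F] {v v' : Fin 3 → Fin 3 → F}

namespace DualBases

/-- The points of the conic `x y = k`, including its two points at infinity. -/
def hyperbola (h : DualBases v v') (k : F) : Set (Point F) :=
  {P | P = h.base 0 ∨ P = h.base 1 ∨ ∃ t ≠ 0, P = h.aff t (k / t)}

lemma base_zero_mem_hyperbola (h : DualBases v v') (k : F) : h.base 0 ∈ h.hyperbola k := Or.inl rfl

lemma base_two_notMem_hyperbola (h : DualBases v v') (k : F) : h.base 2 ∉ h.hyperbola k := by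
  rintro (h0 | h0 | ⟨t, ht, h0⟩)
  · exact absurd (h.base_injective h0) (by decide)
  · exact absurd (h.base_injective h0) (by decide)
  · rw [← h.aff_zero] at h0
    exact ht (h.aff_inj h0).1.symm

lemma mem_hyperbola_iff (h : DualBases v v') {k : F} (hk : k ≠ 0) (P : Point F) :
    P ∈ h.hyperbola k ↔ (P.rep ⬝ᵥ v' 1) * (P.rep ⬝ᵥ v' 0) = k * (P.rep ⬝ᵥ v' 2) ^ 2 := by
  constructor
  · rintro (rfl | rfl | ⟨t, ht, rfl⟩)
    · obtain ⟨a, ha⟩ := Projectivization.exists_smul_eq_mk_rep F (v 0) (h.ne_zero 0)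
      rw [base, ← ha]
      simp [h _ _, Units.smul_def]
    · obtain ⟨a, ha⟩ := Projectivization.exists_smul_eq_mk_rep F (v 1) (h.ne_zero 1)
      rw [base, ← ha]
      simp [h _ _, Units.smul_def]
    · obtain ⟨a, ha⟩ := Projectivization.exists_smul_eq_mk_rep F (vec v t (k / t))
        (h.vec_ne_zero _ _)
      rw [aff, ← ha]
      simp only [Units.smul_def, smul_dotProduct, h.vec_dot_zero, h.vec_dot_one, h.vec_dot_two,
        smul_eq_mul]
      field_simp
  · intro hP
    by_cases h2 : P.rep ⬝ᵥ v' 2 = 0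
    · rw [h2, zero_pow two_ne_zero, mul_zero] at hP
      rcases mul_eq_zero.1 hP with h1 | h0
      · left
        refine h.eq_base fun j hj => ?_
        fin_cases j
        · exact absurd rfl hj
        · exact h1
        · exact h2
      · right; left
        refine h.eq_base fun j hj => ?_
        fin_cases j
        · exact h0
        · exact absurd rfl hj
        · exact h2
    · right; right
      have h1 : P.rep ⬝ᵥ v' 1 ≠ 0 := by
        intro h1
        rw [h1, zero_mul] at hP
        exact mul_ne_zero hk (pow_ne_zero 2 h2) hP.symm
      refine ⟨_, div_ne_zero h1 h2, ?_⟩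
      conv_lhs => rw [h.eq_aff h2]
      congr 1
      field_simp
      linear_combination hP

open MvPolynomial in
lemma isIrreducibleConic_hyperbola (h : DualBases v v') {k : F} (hk : k ≠ 0) :
    IsIrreducibleConic (h.hyperbola k) := by
  refine ⟨linSubst v' (X 1 * X 0 - C k * X 2 ^ 2), ?_, ?_, ?_⟩
  · have hlin : ∀ j, (∑ i, C (v' j i) * X i : MvPolynomial (Fin 3) F).IsHomogeneous 1 := by
      intro j
      refine IsHomogeneous.sum _ _ _ fun i _ => ?_
      simpa using (isHomogeneous_C (Fin 3) (v' j i)).mul (isHomogeneous_X F i)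
    simp only [linSubst, map_sub, map_mul, map_pow, aeval_X, algHom_C, algebraMap_eq]
    refine IsHomogeneous.sub ((hlin 1).mul (hlin 0)) ?_
    simpa using (isHomogeneous_C (Fin 3) k).mul ((hlin 2).pow 2)
  · set φ := algebraMap F (AlgebraicClosure F) with hφ
    have hk' : φ k ≠ 0 := by simpa using hk
    have hmap : MvPolynomial.map φ (linSubst v' (X 1 * X 0 - C k * X 2 ^ 2))
        = linSubst (fun j i => φ (v' j i)) (X 1 * X 0 - C (φ k) * X 2 ^ 2) := by
      simp [linSubst, algHom_C, algebraMap_eq]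
    rw [hmap]
    have hs : ∀ {v v' : Fin 3 → Fin 3 → F}, DualBases v v' → ∀ i l,
        ∑ j, φ (v' j i) * φ (v j l) = if i = l then 1 else 0 := by
      intro v v' h i l
      rw [← map_one φ, ← map_zero φ, ← apply_ite φ, ← h.sum_mul i l, map_sum]
      simp
    have hd : ∀ i l, ∑ j, φ (v' i j) * φ (v l j) = if i = l then 1 else 0 := by
      intro i l
      rw [← map_one φ, ← map_zero φ, ← apply_ite φ, ← h.symm i l, dotProduct, map_sum]
      simp
    refine irreducible_linSubst (v := fun j i => φ (v i j)) hd (fun i l => ?_)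
      (irreducible_X_mul_X_sub hk')
    rw [← hs h.symm i l]
  · ext P
    rw [h.mem_hyperbola_iff hk, zeroLocus, Set.mem_ofPred_eq]
    have hlin : ∀ j, eval P.rep (∑ i, C (v' j i) * X i) = P.rep ⬝ᵥ v' j := by
      intro j
      simp [dotProduct, mul_comm]
    simp only [linSubst, map_sub, map_mul, map_pow, aeval_X, algHom_C, algebraMap_eq, hlin, eval_C]
    rw [sub_eq_zero]

/-- `(s : t)` is the parameter of the point `P` of the hyperbola. -/
def IsParam (h : DualBases v v') (k : F) (P : Point F) (s t : F) : Prop :=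
  (P = h.base 0 ∧ s = 1 ∧ t = 0) ∨ (P = h.base 1 ∧ s = 0 ∧ t = 1) ∨
    (t ≠ 0 ∧ s = 1 ∧ P = h.aff t (k / t))

lemma exists_isParam (h : DualBases v v') {k : F} {P : Point F} (hP : P ∈ h.hyperbola k) :
    ∃ s t, h.IsParam k P s t := by
  rcases hP with rfl | rfl | ⟨t, ht, rfl⟩
  · exact ⟨1, 0, Or.inl ⟨rfl, rfl, rfl⟩⟩
  · exact ⟨0, 1, Or.inr (Or.inl ⟨rfl, rfl, rfl⟩)⟩
  · exact ⟨1, t, Or.inr (Or.inr ⟨ht, rfl, rfl⟩)⟩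

lemma IsParam.inj {h : DualBases v v'} {k : F} {P P₁ : Point F} {s t s₁ t₁ : F}
    (hP : h.IsParam k P s t) (hP₁ : h.IsParam k P₁ s₁ t₁) (hne : P ≠ P₁) :
    s * t₁ - s₁ * t ≠ 0 := by
  rcases hP with ⟨rfl, rfl, rfl⟩ | ⟨rfl, rfl, rfl⟩ | ⟨ht, rfl, rfl⟩ <;>
  rcases hP₁ with ⟨rfl, rfl, rfl⟩ | ⟨rfl, rfl, rfl⟩ | ⟨ht₁, rfl, rfl⟩ <;>
  simp_all
  intro he
  exact hne (by rw [sub_eq_zero.1 he])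

lemma IsParam.eq_zero {h : DualBases v v'} {k : F} {P : Point F} {s t : F}
    (hP : h.IsParam k P s t) {l : Line F} (hl : P ∈ l) :
    s * t * (v 2 ⬝ᵥ l.rep) + t ^ 2 * (v 1 ⬝ᵥ l.rep) + s ^ 2 * (k * (v 0 ⬝ᵥ l.rep)) = 0 := by
  rcases hP with ⟨rfl, rfl, rfl⟩ | ⟨rfl, rfl, rfl⟩ | ⟨ht, rfl, rfl⟩
  · rw [base, mk_mem_iff] at hl
    simp [hl]
  · rw [base, mk_mem_iff] at hl
    simp [hl]
  · rw [aff, mk_mem_iff, vec_dot] at hl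
    field_simp at hl
    linear_combination hl

/-- In terms of the parameter, a line meets the conic in the zeros of a binary quadratic form. -/
lemma hyperbola_no_three (h : DualBases v v') {k : F} (hk : k ≠ 0) {P₁ P₂ P₃ : Point F}
    (h₁ : P₁ ∈ h.hyperbola k) (h₂ : P₂ ∈ h.hyperbola k) (h₃ : P₃ ∈ h.hyperbola k)
    (h₁₂ : P₁ ≠ P₂) (h₁₃ : P₁ ≠ P₃) (h₂₃ : P₂ ≠ P₃) (l : Line F)
    (hl₁ : P₁ ∈ l) (hl₂ : P₂ ∈ l) (hl₃ : P₃ ∈ l) : False := by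
  obtain ⟨s₁, t₁, p₁⟩ := h.exists_isParam h₁
  obtain ⟨s₂, t₂, p₂⟩ := h.exists_isParam h₂
  obtain ⟨s₃, t₃, p₃⟩ := h.exists_isParam h₃
  have d₁₂ := p₁.inj p₂ h₁₂
  have d₁₃ := p₁.inj p₃ h₁₃
  have d₂₃ := p₂.inj p₃ h₂₃
  have e₁ := p₁.eq_zero hl₁
  have e₂ := p₂.eq_zero hl₂
  have e₃ := p₃.eq_zero hl₃
  have hd := mul_ne_zero (mul_ne_zero d₁₂ d₁₃) d₂₃
  generalize hc : v 2 ⬝ᵥ l.rep = c at e₁ e₂ e₃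
  generalize hb : v 1 ⬝ᵥ l.rep = b at e₁ e₂ e₃
  generalize ha : v 0 ⬝ᵥ l.rep = a at e₁ e₂ e₃
  have hb0 : b = 0 := by
    refine (mul_eq_zero.1 (?_ : ((s₁ * t₂ - s₂ * t₁) * (s₁ * t₃ - s₃ * t₁) *
      (s₂ * t₃ - s₃ * t₂)) * b = 0)).resolve_left hd
    linear_combination (s₂ * s₃ * (s₂ * t₃ - s₃ * t₂)) * e₁ - (s₁ * s₃ * (s₁ * t₃ - s₃ * t₁)) * e₂
      + (s₁ * s₂ * (s₁ * t₂ - s₂ * t₁)) * e₃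
  have ha0 : k * a = 0 := by
    refine (mul_eq_zero.1 (?_ : ((s₁ * t₂ - s₂ * t₁) * (s₁ * t₃ - s₃ * t₁) *
      (s₂ * t₃ - s₃ * t₂)) * (k * a) = 0)).resolve_left hd
    linear_combination (t₂ * t₃ * (s₂ * t₃ - s₃ * t₂)) * e₁ - (t₁ * t₃ * (s₁ * t₃ - s₃ * t₁)) * e₂
      + (t₁ * t₂ * (s₁ * t₂ - s₂ * t₁)) * e₃
  have hc0 : c = 0 := by
    refine (mul_eq_zero.1 (?_ : ((s₁ * t₂ - s₂ * t₁) * (s₁ * t₃ - s₃ * t₁) *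
      (s₂ * t₃ - s₃ * t₂)) * c = 0)).resolve_left hd
    linear_combination (s₃ ^ 2 * t₂ ^ 2 - s₂ ^ 2 * t₃ ^ 2) * e₁
      + (s₁ ^ 2 * t₃ ^ 2 - s₃ ^ 2 * t₁ ^ 2) * e₂ + (s₂ ^ 2 * t₁ ^ 2 - s₁ ^ 2 * t₂ ^ 2) * e₃
  refine l.rep_nonzero (h.symm.ext_dot ?_ ?_ ?_) <;>
  rw [dotProduct_comm, zero_dotProduct]
  · rw [ha]; exact (mul_eq_zero.1 ha0).resolve_left hk
  · rw [hb, hb0]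
  · rw [hc, hc0]

lemma ncard_hyperbola [Finite F] (h : DualBases v v') (k : F) :
    (h.hyperbola k).ncard = Nat.card F + 1 := by
  have himg : h.hyperbola k
      = insert (h.base 0) (insert (h.base 1) ((fun t => h.aff t (k / t)) '' {0}ᶜ)) := by
    ext P
    simp only [hyperbola, Set.mem_ofPred_eq, Set.mem_insert_iff, Set.mem_image, Set.mem_compl_iff,
      Set.mem_singleton_iff]
    simp [eq_comm]
  have hinj : Function.Injective fun t => h.aff t (k / t) := fun t s hts => (h.aff_inj hts).1
  rw [himg, Set.ncard_insert_of_notMem, Set.ncard_insert_of_notMem,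
    Set.ncard_image_of_injective _ hinj, Set.ncard_compl, Set.ncard_singleton]
  · have : 0 < Nat.card F := Nat.card_pos
    omega
  · rintro ⟨t, -, ht⟩
    exact h.base_ne_aff (by decide) _ _ ht.symm
  · rintro (h0 | ⟨t, -, ht⟩)
    · exact absurd (h.base_injective h0) (by decide)
    · exact h.base_ne_aff (by decide) _ _ ht.symm

lemma isDualOval_hyperbola [Finite F] (h : DualBases v v') {k : F} (hk : k ≠ 0) :
    IsDualOval (h.hyperbola k) := by
  refine ⟨h.ncard_hyperbola k, fun l₁ h₁ l₂ h₂ l₃ h₃ h₁₂ h₁₃ h₂₃ => ?_⟩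
  rintro ⟨P, hP₁, hP₂, hP₃⟩
  refine h.hyperbola_no_three hk h₁ h₂ h₃ h₁₂ h₁₃ h₂₃ P ?_ ?_ ?_ <;>
  rwa [mem_iff_rep, dotProduct_comm, ← mem_iff_rep]

/-- The asymptotes: the line through the origin and the point at infinity `base i`. -/
def asymptote (h : DualBases v v') (i : Fin 3) : Line F := h.symm.base i

lemma base_mem_asymptote (h : DualBases v v') (i j : Fin 3) :
    h.base i ∈ h.asymptote j ↔ i ≠ j := by
  rw [base, asymptote, base, mk_mem_mk, h]
  simp

lemma aff_mem_asymptote (h : DualBases v v') {k t : F} (hk : k ≠ 0) (ht : t ≠ 0) {j : Fin 3}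
    (hj : j ≠ 2) : h.aff t (k / t) ∉ h.asymptote j := by
  rw [aff, asymptote, base, mk_mem_mk]
  fin_cases j
  · simp [h.vec_dot_zero, hk, ht]
  · simp [h.vec_dot_one, ht]
  · exact absurd rfl hj

/-- Each asymptote is a tangent, touching the conic at infinity. -/
lemma eq_base_of_mem_asymptote (h : DualBases v v') {k : F} (hk : k ≠ 0) {P : Point F}
    (hP : P ∈ h.hyperbola k) {i j : Fin 3} (hij : (i = 0 ∧ j = 1) ∨ (i = 1 ∧ j = 0))
    (hPj : P ∈ h.asymptote j) : P = h.base i := by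
  rcases hP with rfl | rfl | ⟨t, ht, rfl⟩
  · rcases hij with ⟨rfl, rfl⟩ | ⟨rfl, rfl⟩
    · rfl
    · exact absurd rfl ((h.base_mem_asymptote _ _).1 hPj)
  · rcases hij with ⟨rfl, rfl⟩ | ⟨rfl, rfl⟩
    · exact absurd rfl ((h.base_mem_asymptote _ _).1 hPj)
    · rfl
  · refine absurd hPj (h.aff_mem_asymptote hk ht ?_)
    rcases hij with ⟨rfl, rfl⟩ | ⟨rfl, rfl⟩ <;> decide

lemma isExternalPoint_hyperbola (h : DualBases v v') (h2 : (2 : F) ≠ 0) {k : F} (hk : k ≠ 0) :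
    IsExternalPoint (h.hyperbola k) (h.base 2) := by
  refine ⟨h.base_two_notMem_hyperbola k, ?_⟩
  have hset : {l : Line F | h.base 2 ∈ l ∧ IsTangent (h.hyperbola k) l}
      = {h.asymptote 0, h.asymptote 1} := by
    ext l
    rw [Set.mem_ofPred_eq, Set.mem_insert_iff, Set.mem_singleton_iff]
    constructor
    · rintro ⟨h2l, P, ⟨hP, hPl⟩, huniq⟩
      have h2l' : v 2 ⬝ᵥ l.rep = 0 := by rwa [base, mk_mem_iff] at h2l
      by_cases h0 : v 0 ⬝ᵥ l.rep = 0
      · right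
        refine h.symm.eq_base fun j hj => ?_
        rw [dotProduct_comm]
        fin_cases j
        · exact h0
        · exact absurd rfl hj
        · exact h2l'
      by_cases h1 : v 1 ⬝ᵥ l.rep = 0
      · left
        refine h.symm.eq_base fun j hj => ?_
        rw [dotProduct_comm]
        fin_cases j
        · exact absurd rfl hj
        · exact h1
        · exact h2l'
      exfalso
      rcases hP with rfl | rfl | ⟨t, ht, rfl⟩
      · rw [base, mk_mem_iff] at hPl
        exact h0 hPl
      · rw [base, mk_mem_iff] at hPl
        exact h1 hPl
      · -- the reflection in the centre gives a second point on the line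
        have h3 := huniq (h.aff (-t) (k / -t))
          ⟨Or.inr (Or.inr ⟨-t, neg_ne_zero.2 ht, rfl⟩), by
            rw [aff, mk_mem_iff, vec_dot, h2l'] at hPl ⊢
            rw [div_neg]
            linear_combination -hPl⟩
        exact neg_ne_self_of_two_ne_zero h2 ht (h.aff_inj h3).1
    · rintro (rfl | rfl)
      · exact ⟨(h.base_mem_asymptote _ _).2 (by decide), h.base 1,
          ⟨Or.inr (Or.inl rfl), (h.base_mem_asymptote _ _).2 (by decide)⟩, fun P hP =>
          h.eq_base_of_mem_asymptote hk hP.1 (Or.inr ⟨rfl, rfl⟩) hP.2⟩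
      · exact ⟨(h.base_mem_asymptote _ _).2 (by decide), h.base 0,
          ⟨Or.inl rfl, (h.base_mem_asymptote _ _).2 (by decide)⟩, fun P hP =>
          h.eq_base_of_mem_asymptote hk hP.1 (Or.inl ⟨rfl, rfl⟩) hP.2⟩
  rw [hset, Set.ncard_pair]
  exact fun he => absurd (h.symm.base_injective he) (by decide)

end DualBases

end Conic

/-! ### Kakeya sets -/

section Kakeya

variable {F : Type*} [Field F]

lemma mem_comm (P l : Point F) : (P ∈ (l : Line F)) ↔ (l ∈ (P : Line F)) := by
  rw [mem_iff_rep, dotProduct_comm, ← mem_iff_rep]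

lemma eq_of_mem_mem {P Q : Point F} {l m : Line F} (hPQ : P ≠ Q) (hPl : P ∈ l) (hQl : Q ∈ l)
    (hPm : P ∈ m) (hQm : Q ∈ m) : l = m :=
  (Configuration.Nondegenerate.eq_or_eq hPl hQl hPm hQm).resolve_left hPQ

/-- In the dual plane a Kakeya configuration is a set with an internal nucleus. -/
lemma IsTransversalFamily.isInternalNucleus {l : Line F} {m : Point F → Line F}
    (h : IsTransversalFamily l m) : IsInternalNucleus (insert l (m '' pts l)) l := by
  refine ⟨Set.mem_insert _ _, fun P hP => ?_⟩
  have hP' : P ∈ pts l := (mem_comm P l).2 hP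
  refine ⟨m P, ⟨Or.inr ⟨P, hP', rfl⟩, (h P hP').2, (mem_comm _ _).1 (h P hP').1⟩, ?_⟩
  rintro Q ⟨hQ | ⟨R, hR, rfl⟩, hQl, hQP⟩
  · exact absurd hQ hQl
  · by_contra hne
    have hRP : R ≠ P := fun hRP => hne (by rw [hRP])
    exact hQl (eq_of_mem_mem hRP (h R hR).1 ((mem_comm _ _).1 hQP) hR hP')

lemma kakeyaSet_eq (l : Line F) (m : Point F → Line F) :
    kakeyaSet l m = linesMeeting (insert l (m '' pts l)) \ {P | l ∈ (P : Line F)} := by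
  ext P
  constructor
  · rintro ⟨hP, hPl⟩
    simp only [Set.mem_iUnion] at hP
    obtain ⟨Q, hQ, hPQ⟩ := hP
    exact ⟨⟨m Q, Or.inr ⟨Q, hQ, rfl⟩, (mem_comm _ _).1 hPQ⟩, fun hl => hPl ((mem_comm _ _).2 hl)⟩
  · rintro ⟨⟨R, hR | ⟨Q, hQ, rfl⟩, hRP⟩, hPl⟩
    · exact absurd (hR ▸ hRP) hPl
    · refine ⟨?_, fun hl => hPl ((mem_comm _ _).1 hl)⟩
      simp only [Set.mem_iUnion]
      exact ⟨Q, hQ, (mem_comm _ _).2 hRP⟩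

/-- Equality in the bound yields a conic together with an external point, read as a dual oval and
a further line. -/
lemma IsTransversalFamily.isAssociated [Finite F] (hq : Odd (Nat.card F)) {l : Line F}
    {m : Point F → Line F} (h : IsTransversalFamily l m)
    (heq : 2 * (kakeyaSet l m).ncard + 1 = Nat.card F ^ 2 + 2 * Nat.card F) :
    ∃ (O : Set (Line F)) (lA : Line F), IsAssociated O l lA (kakeyaSet l m) := by
  rw [kakeyaSet_eq] at heq
  obtain ⟨v, v', d, k, hk, rfl, hΩ⟩ := h.isInternalNucleus.exists_hyperbola hq heq
  have hA : d.asymptote 1 ∈ d.base 0 :=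
    (mem_comm _ _).1 ((d.base_mem_asymptote 0 1).2 (by decide))
  have hA2 : d.asymptote 1 ∈ d.base 2 :=
    (mem_comm _ _).1 ((d.base_mem_asymptote 2 1).2 (by decide))
  have hne : d.base 2 ≠ d.base 0 := fun he => absurd (d.base_injective he) (by decide)
  have hcases : ∀ P ∈ pts (d.base 0), m P ∈ d.hyperbola k ∨ m P = d.base 2 := by
    intro P hP
    rcases (hΩ (m P)).1 (Or.inr ⟨P, hP, rfl⟩) with h0 | h1 | h2 | h3
    · exact Or.inl (Or.inl h0)
    · exact Or.inl (Or.inr (Or.inl h1))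
    · exact Or.inr h2
    · exact Or.inl (Or.inr (Or.inr h3))
  refine ⟨d.hyperbola k, d.base 2, d.isDualOval_hyperbola hk, d.base_zero_mem_hyperbola k,
    d.asymptote 1, hA, fun n hn hAn => d.eq_base_of_mem_asymptote hk hn (Or.inl ⟨rfl, rfl⟩)
      ((mem_comm _ _).1 hAn), hA2, hne, m, ?_, ?_, rfl⟩
  · refine (hcases _ hA).resolve_left fun hmem => (h (d.asymptote 1) hA).2 ?_
    exact d.eq_base_of_mem_asymptote hk hmem (Or.inl ⟨rfl, rfl⟩)
      ((mem_comm _ _).1 (h (d.asymptote 1) hA).1)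
  · intro P hP hPA
    refine ⟨(hcases P hP).resolve_right fun h2 => hPA ?_, h P hP⟩
    by_contra hne'
    exact hne (eq_of_mem_mem hPA (h2 ▸ (h P hP).1) hA2 hP hA)

/-- The Kakeya sets associated to dual ovals attain the bound. -/
lemma IsAssociated.ncard_eq [Finite F] (hq : Odd (Nat.card F)) {O : Set (Line F)} {l lA : Line F}
    {K : Set (Point F)} (h : IsAssociated O l lA K) :
    2 * K.ncard + 1 = Nat.card F ^ 2 + 2 * Nat.card F := by
  classical
  have := Fintype.ofFinite F
  rw [Nat.card_eq_fintype_card] at hq ⊢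
  obtain ⟨⟨-, hO⟩, hl, A, hAl, -, hAlA, hlA, m, rfl, hm, rfl⟩ := h
  have htr : IsTransversalFamily l m := by
    intro P hP
    by_cases hPA : P = A
    · subst hPA; exact ⟨hAlA, hlA⟩
    · exact (hm P hP hPA).2
  have hN := htr.isInternalNucleus
  obtain ⟨v, v', d, f, rfl, h1, hΩ⟩ := hN.exists_graph (Or.inr ⟨A, hAl, rfl⟩) hlA.symm
  rw [← h1] at hΩ
  rw [kakeyaSet_eq, ncard_linesMeeting_sdiff d f hΩ]
  refine card_metLines_of_arc hq f fun n => ?_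
  have haff : ∀ x, d.aff x (f x) ∈ O := by
    intro x
    rcases (hΩ _).2 (Or.inr (Or.inr ⟨x, rfl⟩)) with h0 | ⟨P, hP, hPx⟩
    · exact absurd h0.symm (d.base_ne_aff (by decide) _ _)
    · rw [← hPx]
      refine (hm P hP fun hPA => ?_).1
      rw [hPA, ← h1] at hPx
      exact d.base_ne_aff (by decide) _ _ hPx
  by_contra! hlt
  obtain ⟨x, y, z, hx, hy, hz, hxy, hxz, hyz⟩ := Finset.two_lt_card_iff.1 hlt
  rw [Finset.mem_filter] at hx hy hz
  have hmem : ∀ x, f x = n.1 * x + n.2 → d.line n ∈ d.aff x (f x) := fun x hx =>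
    (mem_comm _ _).1 ((d.aff_mem_line _ _ n).2 hx)
  exact hO _ (haff x) _ (haff y) _ (haff z) (fun he => hxy (d.aff_inj he).1)
    (fun he => hxz (d.aff_inj he).1) (fun he => hyz (d.aff_inj he).1)
    ⟨d.line n, hmem x hx.2, hmem y hy.2, hmem z hz.2⟩

lemma ncard_lines_through [Finite F] (P : Point F) :
    {l : Line F | P ∈ l}.ncard = Nat.card F + 1 := by
  classical
  have := Fintype.ofFinite (Point F)
  have h1 : Configuration.ProjectivePlane.order (Point F) (Line F) = Nat.card F := by
    have h2 := Configuration.ProjectivePlane.card_points (Point F) (Line F)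
    rw [← Nat.card_eq_fintype_card,
      Projectivization.card_of_finrank F (Fin 3 → F) (n := 3) (by simp)] at h2
    simp only [Finset.sum_range_succ, Finset.sum_range_zero] at h2
    rcases lt_trichotomy (Configuration.ProjectivePlane.order (Point F) (Line F)) (Nat.card F)
      with h | h | h
    · nlinarith
    · exact h
    · nlinarith
  rw [← h1, ← Configuration.ProjectivePlane.lineCount_eq (L := Line F) P]
  rfl

lemma ncard_linesMeeting [Finite F] {Ω : Set (Point F)} {N : Point F} (hN : N ∈ Ω) :
    (linesMeeting Ω).ncard = Nat.card F + 1 + (linesMeeting Ω \ {l | N ∈ l}).ncard := by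
  have hsub : {l : Line F | N ∈ l} ⊆ linesMeeting Ω := fun l hl => ⟨N, hN, hl⟩
  have h1 := Set.ncard_sdiff_add_ncard_of_subset hsub (Set.toFinite _)
  have h2 := ncard_lines_through N
  omega

end Kakeya

end KakeyaPlane

theorem proposition2p7 {F : Type*} [Field F] [Finite F] (q : ℕ) (hq : Nat.card F = q)
    (hodd : Odd q) :
    (∀ K : Set (KakeyaPlane.Point F), KakeyaPlane.IsKakeyaSet K →
      (q : ℚ) * (q + 1) / 2 + ((q : ℚ) - 1) / 2 ≤ (K.ncard : ℚ) ∧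
      ((K.ncard : ℚ) = (q : ℚ) * (q + 1) / 2 + ((q : ℚ) - 1) / 2 ↔
        ∃ (O : Set (KakeyaPlane.Line F)) (l lA : KakeyaPlane.Line F),
          KakeyaPlane.IsAssociated O l lA K)) ∧
    (∀ Ω : Set (KakeyaPlane.Point F), Ω.ncard = q + 2 →
      (∃ N : KakeyaPlane.Point F, KakeyaPlane.IsInternalNucleus Ω N) →
      ((q : ℚ) + 1) * (q + 2) / 2 + ((q : ℚ) - 1) / 2 ≤
        ((KakeyaPlane.linesMeeting Ω).ncard : ℚ) ∧
      (((KakeyaPlane.linesMeeting Ω).ncard : ℚ) =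
          ((q : ℚ) + 1) * (q + 2) / 2 + ((q : ℚ) - 1) / 2 →
        ∃ (C : Set (KakeyaPlane.Point F)) (E : KakeyaPlane.Point F),
          KakeyaPlane.IsIrreducibleConic C ∧ KakeyaPlane.IsExternalPoint C E ∧
          Ω = insert E C)) := by
  subst hq
  refine ⟨?_, ?_⟩
  · rintro K ⟨l, m, hm, rfl⟩
    refine ⟨?_, fun heq => ?_, ?_⟩
    · have h := hm.isInternalNucleus.le_ncard hodd
      rw [← KakeyaPlane.kakeyaSet_eq] at h
      have h' : ((Nat.card F : ℚ)) ^ 2 + 2 * Nat.card F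
          ≤ 2 * ((KakeyaPlane.kakeyaSet l m).ncard : ℚ) + 1 := by exact_mod_cast h
      linarith
    · obtain ⟨O, lA, h⟩ := hm.isAssociated hodd (by
        have h' : 2 * ((KakeyaPlane.kakeyaSet l m).ncard : ℚ) + 1
            = (Nat.card F : ℚ) ^ 2 + 2 * Nat.card F := by rw [heq]; ring
        exact_mod_cast h')
      exact ⟨O, l, lA, h⟩
    · rintro ⟨O, l', lA, h⟩
      have h' : 2 * ((KakeyaPlane.kakeyaSet l m).ncard : ℚ) + 1
            = (Nat.card F : ℚ) ^ 2 + 2 * Nat.card F := by exact_mod_cast h.ncard_eq hodd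
      linarith
  · rintro Ω - ⟨N, hN⟩
    rw [KakeyaPlane.ncard_linesMeeting hN.1]
    push_cast
    refine ⟨?_, fun heq => ?_⟩
    · have h' : ((Nat.card F : ℚ)) ^ 2 + 2 * Nat.card F
          ≤ 2 * ((KakeyaPlane.linesMeeting Ω \ {l | N ∈ l}).ncard : ℚ) + 1 := by
        exact_mod_cast hN.le_ncard hodd
      linarith
    · obtain ⟨v, v', d, k, hk, rfl, hΩ⟩ := hN.exists_hyperbola hodd (by
        have h' : 2 * ((KakeyaPlane.linesMeeting Ω \ {l | N ∈ l}).ncard : ℚ) + 1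
            = (Nat.card F : ℚ) ^ 2 + 2 * Nat.card F := by linarith
        exact_mod_cast h')
      have h2 : (2 : F) ≠ 0 := by
        have := Fintype.ofFinite F
        exact KakeyaPlane.two_ne_zero_of_odd_card (by rwa [← Nat.card_eq_fintype_card])
      refine ⟨d.hyperbola k, d.base 2, d.isIrreducibleConic_hyperbola hk,
        d.isExternalPoint_hyperbola h2 hk, ?_⟩
      ext P
      rw [hΩ, Set.mem_insert_iff, KakeyaPlane.DualBases.hyperbola, Set.mem_ofPred_eq]
      tauto
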